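/- \textbf{Setting.} There are $n\ge 1$ followers $1,\dots,n$ and a leader $n+1$, communicating over a directed graph that contains a directed spanning tree rooted at the leader; $a_{ij}=1$ if there is an edge from $j$ to $i$ (then $j$ is a neighbor of $i$, $j\in\mathcal N_i$) and $a_{ij}=0$ otherwise, with $a_{n+1,j}=0$ for $j\le n$. Let $d_i=|\mathcal N_i|$, $d_*=\max_{i\le n}d_i$, $\mathcal L=\mathrm{diag}(d_1,\dots,d_{n+1})-(a_{ij})$, and let $W$ be the matrix with one row for each link $(i,j)$, $i\le n$, $j\in\mathcal N_i$, that row being the $j$-th unit row vector of $\mathbb R^{n+1}$. Let $\pi$ be the row vector with $\pi\mathcal L=0$, $\sum_j\pi_j=1$, and let $J$ be the $(n+1)\times(n+1)$ matrix all of whose rows equal $\pi$. Let $\Theta=[q,\psi]$ be an invertible (real or complex) matrix with first column $q$ and $\Theta^{-1}=\begin{pmatrix}\tau\\ \phi\end{pmatrix}$, $\tau$ being the first row, such that $\Theta^{-1}\mathcal L\Theta=\mathrm{diag}(0,\tilde{\mathcal L})$ with $\tilde{\mathcal L}$ of size $n\times n$ (for example a Jordan matrix), and let $H>0$ be Hermitian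 with $H\tilde{\mathcal L}+\tilde{\mathcal L}^*H=I$. Put $\lambda_H=\lambda_{\max}(H)$, $h=1/\lambda_{\min}(H)$, $\lambda_\phi=\lambda_{\max}\big((I-J)^T\phi^*H\phi(I-J)\big)$, $\lambda_W=\lambda_{\max}(WW^T)$, $\lambda_L=\lambda_{\max}(\mathcal L\mathcal L^T)$. \textbf{Algorithm.} Let $0<\varepsilon<1$. The leader's state satisfies $x_{n+1}(k+1)=x_{n+1}(k)+f(k)$ with $f(k)=1/k^{1+\varepsilon}$ for $k\ge1$, and $|x_{n+1}(k)|\le\mathcal W$ for all $k\ge 0$, where $\mathcal W$ is the projection bound below. Initially $|x_i(0)|\le\mathcal W$ and $|\hat x_{ij}(0)|\le\mathcal W$ for $i\le n$, $j\in\mathcal N_i$. For $k\ge1$ follower $i$ observes $S_{ij}(k)=\mathbf 1\{x_j(k)+\xi_{ij}(k)\le\mathcal B_{ij}\}$, $j\in\mathcal N_i$, and sets $$\hat x_{ij}(k)=\Pi_{\mathcal W}\Big\{\hat x_{ij}(k-1)+\tfrac{\beta}{k}\big(\mathcal F(\mathcal B_{ij}-\hat x_{ij}(k-1))-S_{ij}(k)\big)\Big\},$$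 where $\Pi_{\mathcal W}$ is the projection onto $[-\mathcal W,\mathcal W]$; for $k\ge0$, $$x_i(k+1)=x_i(k)-\tfrac1{k+1}\sum_{j=1}^{n+1}a_{ij}\big[x_i(k)-\hat x_{ij}(k)\big],\quad i\le n.$$ Here every $\xi_{ij}(k)$ is normal with mean $0$ and a common positive variance, with distribution function $\mathcal F$ and density $f_\xi$, and is independent of the states up to time $k$ and the estimates before time $k$. Let $f_B=f_\xi(B+\mathcal W)$ with $B=\max|\mathcal B_{ij}|$ over all links. \textbf{Theorem.} Let $$Q=\begin{pmatrix}\frac1{2\lambda_H}&-2\lambda_H\lambda_\phi d_*\\-2\lambda_H\lambda_\phi d_*&2\beta f_B-\frac{h\lambda_W\lambda_L}{2\lambda_H\lambda_\phi d_*}-2d_*\end{pmatrix}.$$ Then for all $i=1,\dots,n$ and $j\in\mathcal N_i$, each of $E(\hat x_{ij}(k)-x_j(k))^2$ and $E(x_i(k)-x_{n+1}(k))^2$ is, as $k\to\infty$, $$O\Big(\frac1{k^{\lambda_{\min}(Q)}}\Big)\text{ if }\varepsilon>\lambda_{\min}(Q),\qquad O\Big(\frac{\log k}{k^{\varepsilon}}\Big)\text{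 if }\varepsilon=\lambda_{\min}(Q),\qquad O\Big(\frac1{k^{\varepsilon}}\Big)\text{ if }\varepsilon<\lambda_{\min}(Q).$$ -/

import Mathlib

open MeasureTheory ProbabilityTheory Filter Asymptotics
open scoped NNReal ComplexOrder

noncomputable section

namespace ConsensusTracking

/-! The agents are the elements of `Fin (n + 1)`: the followers are `i.castSucc` for `i : Fin n`
and the leader is `Fin.last n`. In the communication digraph `G`, the relation `G.Adj j i` means
that there is an edge from `j` to `i`, that is, that agent `i` receives information from agent `j`
(so `j` is a neighbor of `i`). -/

section Graph

/-- `T` is a directed tree that spans all the vertices and has root `r`: every vertex other than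
`r` has exactly one parent, `r` has none, and every vertex is reached from `r`. -/
structure IsDirectedSpanningTree {V : Type*} (T : Digraph V) (r : V) : Prop where
  root : ∀ j, ¬ T.Adj j r
  parent : ∀ i, i ≠ r → ∃! j, T.Adj j i
  reachable : ∀ i, Relation.ReflTransGen T.Adj r i

/-- The digraph contains a directed spanning tree with root `r`. -/
def HasDirectedSpanningTree {V : Type*} (G : Digraph V) (r : V) : Prop :=
  ∃ T : Digraph V, (∀ i j, T.Adj i j → G.Adj i j) ∧ IsDirectedSpanningTree T r

variable {n : ℕ} (G : Digraph (Fin (n + 1))) [DecidableRel G.Adj]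

/-- The communication links `(i, j)`: `i` is a follower and `j` is one of its neighbors. -/
abbrev Link : Type :=
  {p : Fin n × Fin (n + 1) // G.Adj p.2 p.1.castSucc}

/-- Adjacency matrix: `a_ij = 1` if there is an edge from `j` to `i`, and `0` otherwise. -/
def adjacency : Matrix (Fin (n + 1)) (Fin (n + 1)) ℝ :=
  Matrix.of fun i j => if G.Adj j i then 1 else 0

/-- The number `d_i` of neighbors of agent `i`. -/
def neighborCount (i : Fin (n + 1)) : ℕ :=
  (Finset.univ.filter fun j => G.Adj j i).card

/-- The Laplacian `D - A`. -/
def laplacian : Matrix (Fin (n + 1)) (Fin (n + 1)) ℝ :=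
  Matrix.diagonal (fun i => (neighborCount G i : ℝ)) - adjacency G

/-- The largest number `d_*` of neighbors of a follower. -/
def maxNeighborCount : ℕ :=
  Finset.univ.sup fun i : Fin n => neighborCount G i.castSucc

/-- The matrix `W` whose row at the link `(i, j)` is the `j`-th unit row vector. -/
def linkMatrix : Matrix (Link G) (Fin (n + 1)) ℝ :=
  Matrix.of fun p j => if p.1.2 = j then 1 else 0

/-- `max |B_ij|` over the links `(i, j)`. -/
def maxThreshold (thr : Fin n → Fin (n + 1) → ℝ) : ℝ :=
  ⨆ p : Link G, |thr p.1.1 p.1.2|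

end Graph

section LinearAlgebra

variable {𝕜 m : Type*} [RCLike 𝕜] [Fintype m] [DecidableEq m]

/-- Largest real eigenvalue; it is used for Hermitian matrices only. -/
def lamMax (A : Matrix m m 𝕜) : ℝ := sSup (spectrum ℝ A)

/-- Smallest real eigenvalue; it is used for Hermitian matrices only. -/
def lamMin (A : Matrix m m 𝕜) : ℝ := sInf (spectrum ℝ A)

/-- The invertible matrix `Θ = [q, ψ]` has the inverse with first row `τ` and lower rows `φ`, and
`Θ⁻¹ L Θ` is block diagonal with blocks `0` (of size one) and `Lt`. -/
structure IsBlockReduction {n : ℕ} (L : Matrix (Fin (n + 1)) (Fin (n + 1)) ℝ)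
    (q : Matrix (Fin (n + 1)) Unit ℂ) (ψ : Matrix (Fin (n + 1)) (Fin n) ℂ)
    (τ : Matrix Unit (Fin (n + 1)) ℂ) (φ : Matrix (Fin n) (Fin (n + 1)) ℂ)
    (Lt : Matrix (Fin n) (Fin n) ℂ) : Prop where
  left_inv : Matrix.fromRows τ φ * Matrix.fromCols q ψ = 1
  right_inv : Matrix.fromCols q ψ * Matrix.fromRows τ φ = 1
  block : Matrix.fromRows τ φ * L.map Complex.ofReal * Matrix.fromCols q ψ
    = Matrix.fromBlocks 0 0 0 Lt

/-- The matrix `(I - J)ᵀ φᴴ H φ (I - J)`, where every row of `J` is `π`. -/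
def weightMatrix {n : ℕ} (π : Fin (n + 1) → ℝ) (φ : Matrix (Fin n) (Fin (n + 1)) ℂ)
    (H : Matrix (Fin n) (Fin n) ℂ) : Matrix (Fin (n + 1)) (Fin (n + 1)) ℂ :=
  let E : Matrix (Fin (n + 1)) (Fin (n + 1)) ℂ :=
    1 - Matrix.of fun _ j => ((π j : ℝ) : ℂ)
  E.conjTranspose * φ.conjTranspose * H * φ * E

/-- The symmetric `2 × 2` matrix `Q` that governs the rate. -/
def rateMatrix {n : ℕ} (G : Digraph (Fin (n + 1))) [DecidableRel G.Adj]
    (π : Fin (n + 1) → ℝ) (φ : Matrix (Fin n) (Fin (n + 1)) ℂ) (H : Matrix (Fin n) (Fin n) ℂ)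
    (β fB : ℝ) : Matrix (Fin 2) (Fin 2) ℝ :=
  let lamH : ℝ := lamMax H
  let h : ℝ := 1 / lamMin H
  let lamPhi : ℝ := lamMax (weightMatrix π φ H)
  let lamW : ℝ := lamMax (linkMatrix G * (linkMatrix G).transpose)
  let lamL : ℝ := lamMax (laplacian G * (laplacian G).transpose)
  let d : ℝ := (maxNeighborCount G : ℝ)
  !![1 / (2 * lamH), -2 * lamH * lamPhi * d;
     -2 * lamH * lamPhi * d, 2 * β * fB - h * lamW * lamL / (2 * lamH * lamPhi * d) - 2 * d]

end LinearAlgebra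

section Algorithm

/-- Projection of the real line onto `[-R, R]`. -/
def proj (R y : ℝ) : ℝ :=
  if y < -R then -R else if R < y then R else y

/-- Binary-valued observation: the indicator of `y ≤ b`. -/
def binaryObs (b y : ℝ) : ℝ := if y ≤ b then 1 else 0

variable {n : ℕ} {Ω : Type*} [MeasurableSpace Ω]

/-- The σ-algebra generated by the agents' states up to time `k` and by the neighbor estimates
before time `k`, i.e. by everything that precedes the observation at time `k`. -/
@[reducible]
def history (G : Digraph (Fin (n + 1))) (x : ℕ → Fin (n + 1) → Ω → ℝ)
    (xhat : ℕ → Fin n → Fin (n + 1) → Ω → ℝ) (k : ℕ) : MeasurableSpace Ω :=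
  (⨆ (l : ℕ) (_ : l ≤ k) (i : Fin (n + 1)),
      MeasurableSpace.comap (x l i) inferInstance) ⊔
    (⨆ (l : ℕ) (_ : l < k) (i : Fin n) (j : Fin (n + 1)) (_ : G.Adj j i.castSucc),
      MeasurableSpace.comap (xhat l i j) inferInstance)

/-- On every link the noise is centered Gaussian with variance `v`, and the noise at time `k` is
independent of the system up to the observation at time `k`. -/
structure IsLinkNoise (G : Digraph (Fin (n + 1))) (P : Measure Ω) (v : ℝ≥0)
    (x : ℕ → Fin (n + 1) → Ω → ℝ) (xhat ξ : ℕ → Fin n → Fin (n + 1) → Ω → ℝ) : Prop where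
  measurable : ∀ k i j, 1 ≤ k → G.Adj j i.castSucc → Measurable (ξ k i j)
  law : ∀ k i j, 1 ≤ k → G.Adj j i.castSucc → P.map (ξ k i j) = gaussianReal 0 v
  indep : ∀ k i j, 1 ≤ k → G.Adj j i.castSucc →
    Indep (MeasurableSpace.comap (ξ k i j) inferInstance) (history G x xhat k) P

/-- `x` (states of the agents) and `xhat` (estimate by follower `i` of the state of its neighbor
`j`) are produced by the algorithm with leader increments `f`, estimation step `β / k`, control
gain `1 / (k + 1)`, projection bound `R`, thresholds `thr`, noise `ξ` and noise distribution
function `F`. -/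
structure IsCRS (G : Digraph (Fin (n + 1))) [DecidableRel G.Adj] (f : ℕ → ℝ) (R β : ℝ)
    (F : ℝ → ℝ) (thr : Fin n → Fin (n + 1) → ℝ)
    (x : ℕ → Fin (n + 1) → Ω → ℝ) (xhat ξ : ℕ → Fin n → Fin (n + 1) → Ω → ℝ) : Prop where
  measurable_state : ∀ k i, Measurable (x k i)
  measurable_estimate : ∀ k i j, G.Adj j i.castSucc → Measurable (xhat k i j)
  init_state : ∀ (i : Fin n) ω, |x 0 i.castSucc ω| ≤ R
  init_estimate : ∀ i j ω, G.Adj j i.castSucc → |xhat 0 i j ω| ≤ R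
  leader_bound : ∀ k ω, |x k (Fin.last n) ω| ≤ R
  leader : ∀ k ω, 1 ≤ k → x (k + 1) (Fin.last n) ω = x k (Fin.last n) ω + f k
  estimate : ∀ k i j ω, 1 ≤ k → G.Adj j i.castSucc →
    xhat k i j ω = proj R (xhat (k - 1) i j ω + β / (k : ℝ) *
      (F (thr i j - xhat (k - 1) i j ω) - binaryObs (thr i j) (x k j ω + ξ k i j ω)))
  control : ∀ k (i : Fin n) ω,
    x (k + 1) i.castSucc ω = x k i.castSucc ω - 1 / ((k : ℝ) + 1) *
      ∑ j, adjacency G i.castSucc j * (x k i.castSucc ω - xhat k i j ω)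

/-- The second moments `E (Z k)²` exist and are `O(g k)` as `k → ∞`. -/
def HasMeanSquareRate (P : Measure Ω) (Z : ℕ → Ω → ℝ) (g : ℕ → ℝ) : Prop :=
  (∀ k, MemLp (Z k) 2 P) ∧ (fun k => ∫ ω, (Z k ω) ^ 2 ∂P) =O[atTop] g

/-- The mean-square rate of `Z`, in the three cases given by comparing `ε` with `ρ`. -/
def HasThreeCaseRate (P : Measure Ω) (Z : ℕ → Ω → ℝ) (ε ρ : ℝ) : Prop :=
  (ρ < ε → HasMeanSquareRate P Z fun k => 1 / (k : ℝ) ^ ρ) ∧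
  (ε = ρ → HasMeanSquareRate P Z fun k => Real.log k / (k : ℝ) ^ ε) ∧
  (ε < ρ → HasMeanSquareRate P Z fun k => 1 / (k : ℝ) ^ ε)

end Algorithm

end ConsensusTracking

end

/-!
Why the theorem holds. All agents are compared with the leader: put `δ_i = x_i - x_{n+1}` and
`z_ij = x̂_ij - x_{n+1}`. Up to errors of order `k ^ (-1 - ε)` and the observation noise, one step
replaces `δ_i` by an average of itself and the `z_ij`, and `z_ij` by an average of itself and `δ_j`:
by the mean value theorem the innovation `F(B - x̂) - F(B - x_j)` is `-c (x̂ - x_j)`, where the random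
slope `c` lies between `f_B` and the maximal noise density. The dynamics is thus a positive linear
system with random coefficients, and it is enough to find a positive vector which every such step
contracts by a factor `1 - σ / k`, with one `σ > λ_min(Q) / 2`.

Let `ρ = λ_min(Q) > 0`. It is bounded by both diagonal entries of `Q`, which gives `ρ ≤ 1 / (2 λ_H)`
and `ρ ≤ 2 β f_B - 2 d_*`. By the Lyapunov equation the follower block of the Laplacian has no real
eigenvalue in `[0, ρ)` (`eq_zero_of_followerLaplacian_mulVec`), so its resolvent applied to the
vector of ones stays positive on this interval (`exists_pos_followerLaplacian_mulVec`). This gives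
weights `w` for the states; the estimates get the weights `t w` with a suitable `t > 1`
(`exists_weights`), and the second bound on `ρ` provides the contraction for them, whatever the
slope `c ≥ f_B` is.

Contraction in a weighted maximum norm is not suited to the noise, so it is replaced by contraction
of weighted sums of `p`-th powers with `p` even. By Jensen's inequality such a sum is
multiplied by at most `exp (-((p - 1) σ - C₁) / k)` where `C₁` does not depend on `p`
(`IsCRS.exists_momentSum_recursion`). As `2 σ > ρ`, for large `p` the exponent exceeds `p s / 2` with
`s = min ρ ε`. The projection only brings an estimate closer to the leader's state, and the noise is
centered given the past (`integral_mul_cdf_sub_binaryObs_eq_zero`), so that both it and the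
errors contribute `O(k ^ (-1 - p s / 2))`. Hence the `p`-th moments are `O(k ^ (-p s / 2))` and the
mean squares are `O(k ^ (-s))`, which is at least as good as each of the three asserted rates.
For `ρ ≤ 0` the rates only say that the trajectories are bounded.
-/

namespace ConsensusTracking

/-! ### Extreme eigenvalues of Hermitian matrices -/

section Spectral

variable {𝕜 m : Type*} [RCLike 𝕜] [Fintype m] [DecidableEq m]

theorem posSemidef_of_spectrum_nonneg {A : Matrix m m 𝕜} (hA : A.IsHermitian)
    (h : ∀ r ∈ spectrum ℝ A, 0 ≤ r) : A.PosSemidef :=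
  hA.posSemidef_iff_eigenvalues_nonneg.2 fun i => h _ (hA.eigenvalues_mem_spectrum_real i)

theorem posSemidef_lamMax_sub {A : Matrix m m 𝕜} (hA : A.IsHermitian) :
    (algebraMap ℝ (Matrix m m 𝕜) (lamMax A) - A).PosSemidef := by
  refine posSemidef_of_spectrum_nonneg (Matrix.IsHermitian.sub ?_ hA) fun r hr => ?_
  · exact IsSelfAdjoint.algebraMap _ (IsSelfAdjoint.all _)
  · rw [← spectrum.singleton_sub_eq] at hr
    obtain ⟨_, rfl, s, hs, rfl⟩ := hr
    exact sub_nonneg.2 (le_csSup (Matrix.finite_real_spectrum).bddAbove hs)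

theorem posSemidef_sub_lamMin {A : Matrix m m 𝕜} (hA : A.IsHermitian) :
    (A - algebraMap ℝ (Matrix m m 𝕜) (lamMin A)).PosSemidef := by
  refine posSemidef_of_spectrum_nonneg (Matrix.IsHermitian.sub hA ?_) fun r hr => ?_
  · exact IsSelfAdjoint.algebraMap _ (IsSelfAdjoint.all _)
  · rw [← spectrum.sub_singleton_eq] at hr
    obtain ⟨s, hs, _, rfl, rfl⟩ := hr
    exact sub_nonneg.2 (csInf_le (Matrix.finite_real_spectrum).bddBelow hs)

theorem lamMin_le_diag {A : Matrix m m ℝ} (hA : A.IsHermitian) (i : m) : lamMin A ≤ A i i := by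
  have := (posSemidef_sub_lamMin hA).diag_nonneg (i := i)
  simpa [Matrix.algebraMap_eq_diagonal] using this

theorem spectrum_real_nonneg {A : Matrix m m 𝕜} (hA : A.PosSemidef) {r : ℝ}
    (hr : r ∈ spectrum ℝ A) : 0 ≤ r := by
  rw [hA.1.spectrum_real_eq_range_eigenvalues] at hr
  obtain ⟨i, rfl⟩ := hr
  exact hA.eigenvalues_nonneg i

theorem lamMax_nonneg {A : Matrix m m 𝕜} (hA : A.PosSemidef) : 0 ≤ lamMax A :=
  Real.sSup_nonneg fun _ hr => spectrum_real_nonneg hA hr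

theorem lamMin_nonneg {A : Matrix m m 𝕜} (hA : A.PosSemidef) : 0 ≤ lamMin A :=
  Real.sInf_nonneg fun _ hr => spectrum_real_nonneg hA hr

theorem quadForm_le_lamMax {A : Matrix m m 𝕜} (hA : A.IsHermitian) (y : m → 𝕜) :
    RCLike.re (star y ⬝ᵥ A.mulVec y) ≤ lamMax A * RCLike.re (star y ⬝ᵥ y) := by
  have := (posSemidef_lamMax_sub hA).re_dotProduct_nonneg y
  rw [Matrix.sub_mulVec, dotProduct_sub, map_sub, sub_nonneg] at this
  refine this.trans_eq ?_
  rw [Algebra.algebraMap_eq_smul_one, Matrix.smul_mulVec, Matrix.one_mulVec, dotProduct_smul,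
    RCLike.smul_re]

end Spectral

/-! ### Diagonal entries of the rate matrix -/

section Rate
variable {n : ℕ} {G : Digraph (Fin (n + 1))} [DecidableRel G.Adj]

theorem rateMatrix_isHermitian (π : Fin (n + 1) → ℝ) (φ : Matrix (Fin n) (Fin (n + 1)) ℂ)
    (H : Matrix (Fin n) (Fin n) ℂ) (β fB : ℝ) : (rateMatrix G π φ H β fB).IsHermitian := by
  refine Matrix.IsHermitian.ext fun i j => ?_
  fin_cases i <;> fin_cases j <;> simp [rateMatrix]

theorem lamMin_rateMatrix_le_left (π : Fin (n + 1) → ℝ) (φ : Matrix (Fin n) (Fin (n + 1)) ℂ)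
    (H : Matrix (Fin n) (Fin n) ℂ) (β fB : ℝ) :
    lamMin (rateMatrix G π φ H β fB) ≤ 1 / (2 * lamMax H) :=
  (lamMin_le_diag (rateMatrix_isHermitian π φ H β fB) 0).trans_eq (by simp [rateMatrix])

theorem weightMatrix_posSemidef (π : Fin (n + 1) → ℝ) (φ : Matrix (Fin n) (Fin (n + 1)) ℂ)
    {H : Matrix (Fin n) (Fin n) ℂ} (hH : H.PosDef) : (weightMatrix π φ H).PosSemidef := by
  have := hH.posSemidef.conjTranspose_mul_mul_same
    (φ * (1 - Matrix.of fun _ j => ((π j : ℝ) : ℂ) : Matrix (Fin (n + 1)) (Fin (n + 1)) ℂ))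
  rw [Matrix.conjTranspose_mul] at this
  simpa only [weightMatrix, Matrix.mul_assoc] using this

/-- The subtracted quotient in the lower right entry of `Q` is nonnegative, also when its denominator
vanishes and the quotient has the value `0`. -/
theorem lamMin_rateMatrix_le_right (π : Fin (n + 1) → ℝ) (φ : Matrix (Fin n) (Fin (n + 1)) ℂ)
    {H : Matrix (Fin n) (Fin n) ℂ} (hH : H.PosDef) (β fB : ℝ) :
    lamMin (rateMatrix G π φ H β fB) ≤ 2 * (β * fB) - 2 * maxNeighborCount G := by
  refine (lamMin_le_diag (rateMatrix_isHermitian π φ H β fB) 1).trans ?_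
  have h1 := lamMax_nonneg hH.posSemidef
  have h2 := lamMin_nonneg hH.posSemidef
  have h3 := lamMax_nonneg (weightMatrix_posSemidef π φ hH)
  have h4 := lamMax_nonneg (Matrix.posSemidef_self_mul_conjTranspose (linkMatrix G))
  have h5 := lamMax_nonneg (Matrix.posSemidef_self_mul_conjTranspose (laplacian G))
  rw [Matrix.conjTranspose_eq_transpose_of_trivial] at h4 h5
  have h6 : 0 ≤ 1 / lamMin H * lamMax (linkMatrix G * (linkMatrix G).transpose)
      * lamMax (laplacian G * (laplacian G).transpose)
      / (2 * lamMax H * lamMax (weightMatrix π φ H) * maxNeighborCount G) := by positivity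
  simp only [rateMatrix, Matrix.of_apply, Matrix.cons_val_one,
    Matrix.cons_val_fin_one]
  linarith

end Rate

/-! ### Positive vectors for the follower block of the Laplacian -/

section Perron
variable {n : ℕ} {G : Digraph (Fin (n + 1))} [DecidableRel G.Adj]

/-- The block of the Laplacian that belongs to the followers. -/
noncomputable def followerLaplacian (G : Digraph (Fin (n + 1))) [DecidableRel G.Adj] :
    Matrix (Fin n) (Fin n) ℝ :=
  (laplacian G).submatrix Fin.castSucc Fin.castSucc

theorem sum_adjacency (i : Fin (n + 1)) : ∑ j, adjacency G i j = neighborCount G i := by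
  simp [adjacency, neighborCount]

theorem laplacian_mulVec (y : Fin (n + 1) → ℝ) (i : Fin (n + 1)) :
    (laplacian G).mulVec y i = neighborCount G i * y i - ∑ j, adjacency G i j * y j := by
  rw [laplacian, Matrix.sub_mulVec, Pi.sub_apply, Matrix.mulVec_diagonal]
  rfl

theorem laplacian_mulVec_eq_sum (y : Fin (n + 1) → ℝ) (i : Fin (n + 1)) :
    (laplacian G).mulVec y i = ∑ j, adjacency G i j * (y i - y j) := by
  simp [laplacian_mulVec, mul_sub, Finset.sum_sub_distrib, ← Finset.sum_mul, sum_adjacency]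

theorem laplacian_mulVec_one : (laplacian G).mulVec 1 = 0 := by
  ext i; simp [laplacian_mulVec_eq_sum]

theorem laplacian_mulVec_last (hleader : ∀ j : Fin n, ¬ G.Adj j.castSucc (Fin.last n))
    (y : Fin (n + 1) → ℝ) : (laplacian G).mulVec y (Fin.last n) = 0 := by
  simp [laplacian_mulVec_eq_sum, Fin.sum_univ_castSucc, adjacency, hleader]

theorem laplacian_mulVec_snoc_castSucc (w : Fin n → ℝ) (c : ℝ) (i : Fin n) :
    (laplacian G).mulVec (Fin.snoc w c : Fin (n + 1) → ℝ) i.castSucc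
      = (followerLaplacian G).mulVec w i + laplacian G i.castSucc (Fin.last n) * c := by
  simp [Matrix.mulVec, dotProduct, Fin.sum_univ_castSucc, followerLaplacian]

/-- The follower block of the Laplacian has no eigenvalue in `[0, 1 / (2 λ_H))`. An eigenvector for
`s`, extended by `0` to the leader, is an eigenvector of `L`; its image `z` under `φ` satisfies
`‖z‖² = 2 s (z^* H z) ≤ 2 s λ_H ‖z‖²` by the Lyapunov equation, hence vanishes. So the extended
vector is a multiple of `q`, and so is the vector of ones, whose last entry is not `0`. -/
theorem eq_zero_of_followerLaplacian_mulVec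
    (hleader : ∀ j : Fin n, ¬ G.Adj j.castSucc (Fin.last n))
    {q : Matrix (Fin (n + 1)) Unit ℂ} {ψ : Matrix (Fin (n + 1)) (Fin n) ℂ}
    {τ : Matrix Unit (Fin (n + 1)) ℂ} {φ : Matrix (Fin n) (Fin (n + 1)) ℂ}
    {Lt : Matrix (Fin n) (Fin n) ℂ} (hΘ : IsBlockReduction (laplacian G) q ψ τ φ Lt)
    {H : Matrix (Fin n) (Fin n) ℂ} (hH : H.PosDef)
    (hLyap : H * Lt + Lt.conjTranspose * H = 1) {s : ℝ} (hs0 : 0 ≤ s)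
    (hs : 2 * s * lamMax H < 1) {w : Fin n → ℝ}
    (hw : (followerLaplacian G).mulVec w = s • w) : w = 0 := by
  have hφ : φ * (laplacian G).map Complex.ofReal = Lt * φ := by
    have h : Matrix.fromRows τ φ * (laplacian G).map Complex.ofReal
        = (Matrix.fromBlocks 0 0 0 Lt : Matrix (Unit ⊕ Fin n) (Unit ⊕ Fin n) ℂ)
          * Matrix.fromRows τ φ := by
      rw [← hΘ.block, Matrix.mul_assoc _ (Matrix.fromCols q ψ), hΘ.right_inv, Matrix.mul_one]
    rw [Matrix.fromRows_mul, Matrix.fromBlocks_mul_fromRows] at h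
    simpa using (Matrix.fromRows_inj.eq_iff.1 h).2
  -- an eigenvector of the Laplacian with a small eigenvalue is annihilated by `φ`
  have key : ∀ (r : ℝ) (y : Fin (n + 1) → ℝ), 0 ≤ r → 2 * r * lamMax H < 1 →
      (laplacian G).mulVec y = r • y → φ.mulVec (fun i => (y i : ℂ)) = 0 := by
    intro r y hr0 hr hy
    set z := φ.mulVec (fun i => (y i : ℂ)) with hz
    have hLz : Lt.mulVec z = (r : ℂ) • z := by
      rw [hz, Matrix.mulVec_mulVec, ← hφ, ← Matrix.mulVec_mulVec, ← Matrix.mulVec_smul]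
      congr 1
      ext i
      have := congrFun hy i
      simp only [Matrix.mulVec, dotProduct, Pi.smul_apply, smul_eq_mul] at this ⊢
      simp only [Matrix.map_apply]
      exact_mod_cast this
    have h1 : star z ⬝ᵥ z = 2 * r * (star z ⬝ᵥ H.mulVec z) := by
      have h2 : star z ⬝ᵥ (H * Lt + Lt.conjTranspose * H).mulVec z
          = 2 * r * (star z ⬝ᵥ H.mulVec z) := by
        rw [Matrix.add_mulVec, dotProduct_add, ← Matrix.mulVec_mulVec, hLz, ← Matrix.mulVec_mulVec,
          Matrix.mulVec_smul, dotProduct_smul, Matrix.dotProduct_mulVec (star z) Lt.conjTranspose,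
          ← Matrix.star_mulVec, hLz, star_smul, smul_dotProduct]
        simp
        ring
      rwa [hLyap, Matrix.one_mulVec] at h2
    have h3 : (star z ⬝ᵥ z).re = 2 * r * (star z ⬝ᵥ H.mulVec z).re := by
      rw [h1]; simp
    have h4 : (star z ⬝ᵥ H.mulVec z).re ≤ lamMax H * (star z ⬝ᵥ z).re :=
      quadForm_le_lamMax hH.1 z
    have h5 : 0 ≤ star z ⬝ᵥ z := dotProduct_star_self_nonneg z
    have h6 : 0 ≤ (star z ⬝ᵥ z).re := (Complex.le_def.1 h5).1
    have h7 : (star z ⬝ᵥ z).re = 0 := by nlinarith [mul_le_mul_of_nonneg_left h4 hr0]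
    have h8 : star z ⬝ᵥ z = 0 := Complex.ext h7 (Complex.le_def.1 h5).2.symm
    exact dotProduct_star_self_eq_zero.1 h8
  -- the kernel of `φ` is the line spanned by `q`
  have hker : ∀ y : Fin (n + 1) → ℂ, φ.mulVec y = 0 → ∃ c : ℂ, ∀ i, y i = c * q i () := by
    intro y hy
    refine ⟨τ.mulVec y (), fun i => ?_⟩
    have h := congrFun (congrArg (fun M => Matrix.mulVec M y) hΘ.right_inv) i
    rw [Matrix.fromCols_mul_fromRows, Matrix.add_mulVec, ← Matrix.mulVec_mulVec,
      ← Matrix.mulVec_mulVec, hy, Matrix.mulVec_zero, add_zero, Matrix.one_mulVec] at h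
    rw [← h, mul_comm]
    simp [Matrix.mulVec, dotProduct]
  obtain ⟨c, hc⟩ := hker _ (key s (Fin.snoc w 0) hs0 hs (by
    ext i
    refine Fin.lastCases ?_ (fun i => ?_) i
    · simp [laplacian_mulVec_last hleader]
    · rw [laplacian_mulVec_snoc_castSucc, hw]; simp))
  obtain ⟨c', hc'⟩ := hker _ (key 0 1 le_rfl (by simp) (by simp [laplacian_mulVec_one]))
  have h1 : c * q (Fin.last n) () = 0 := by rw [← hc]; simp
  have h2 : q (Fin.last n) () ≠ 0 := by
    intro h; have := hc' (Fin.last n); simp [h] at this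
  have h3 : c = 0 := by simpa [h2] using h1
  ext i
  have := hc i.castSucc
  simpa [h3] using this

theorem followerLaplacian_mulVec (w : Fin n → ℝ) (i : Fin n) :
    (followerLaplacian G).mulVec w i
      = ∑ j : Fin n, adjacency G i.castSucc j.castSucc * (w i - w j)
        + adjacency G i.castSucc (Fin.last n) * w i := by
  have h := laplacian_mulVec_snoc_castSucc (G := G) w 0 i
  rw [mul_zero, add_zero] at h
  rw [← h, laplacian_mulVec_eq_sum, Fin.sum_univ_castSucc]
  simp

theorem adjacency_nonneg (i j : Fin (n + 1)) : 0 ≤ adjacency G i j := by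
  simp only [adjacency, Matrix.of_apply]; split_ifs <;> norm_num

/-- If the follower block has no eigenvalue in `[0, s]`, the solution of `(L̂ - s) w = 1` is
positive. This is clear at `s = 0` from the minimum principle; along the interval the smallest entry
varies continuously and cannot vanish, because the row of a vanishing smallest entry would be
nonpositive. -/
theorem exists_pos_followerLaplacian_mulVec {s : ℝ} (hs0 : 0 ≤ s)
    (h : ∀ r ∈ Set.Icc 0 s, ∀ w : Fin n → ℝ,
      (followerLaplacian G).mulVec w = r • w → w = 0) :
    ∃ w : Fin n → ℝ, (∀ i, 0 < w i) ∧ (followerLaplacian G).mulVec w = s • w + 1 := by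
  rcases Nat.eq_zero_or_pos n with rfl | hn
  · exact ⟨0, fun i => i.elim0, funext fun i => i.elim0⟩
  have : Nonempty (Fin n) := ⟨⟨0, hn⟩⟩
  let M : ℝ → Matrix (Fin n) (Fin n) ℝ := fun r => followerLaplacian G - r • 1
  have hMv : ∀ r w, (M r).mulVec w = (followerLaplacian G).mulVec w - r • w := fun r w => by
    simp [M, Matrix.sub_mulVec, Matrix.smul_mulVec]
  have hdet : ∀ r ∈ Set.Icc 0 s, (M r).det ≠ 0 := by
    intro r hr hd
    obtain ⟨w, hw0, hw⟩ := Matrix.exists_mulVec_eq_zero_iff.2 hd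
    exact hw0 (h r hr w (sub_eq_zero.1 (by rw [← hMv, hw])))
  let w : ℝ → Fin n → ℝ := fun r => (M r)⁻¹.mulVec 1
  have hw : ∀ r ∈ Set.Icc 0 s, (followerLaplacian G).mulVec (w r) = r • w r + 1 := by
    intro r hr
    have h1 : (M r).mulVec (w r) = 1 := by
      rw [Matrix.mulVec_mulVec, Matrix.mul_nonsing_inv _ (isUnit_iff_ne_zero.2 (hdet r hr)),
        Matrix.one_mulVec]
    rw [hMv] at h1
    rw [← h1]; abel
  have hMc : Continuous M := by fun_prop
  have hwc : ∀ i, ContinuousOn (fun r => w r i) (Set.Icc 0 s) := by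
    intro i
    have h1 : ContinuousOn (fun r => (M r)⁻¹) (Set.Icc 0 s) := by
      simp only [Matrix.inv_def, Ring.inverse_eq_inv']
      exact (hMc.matrix_det.continuousOn.inv₀ hdet).smul hMc.matrix_adjugate.continuousOn
    have h2 : Continuous fun A : Matrix (Fin n) (Fin n) ℝ => A.mulVec 1 i := by
      simp only [Matrix.mulVec, dotProduct]; fun_prop
    exact h2.comp_continuousOn h1
  -- the smallest entry is continuous, positive at `0`, and never zero
  let g : ℝ → ℝ := fun r => Finset.univ.inf' Finset.univ_nonempty (w r)
  have hgc : ContinuousOn g (Set.Icc 0 s) :=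
    ContinuousOn.finset_inf'_apply _ fun i _ => hwc i
  have hrow : ∀ r ∈ Set.Icc 0 s, ∃ i, w r i = g r ∧
      r * g r + 1 ≤ adjacency G i.castSucc (Fin.last n) * g r := by
    intro r hr
    obtain ⟨i, -, hi⟩ := Finset.exists_mem_eq_inf' Finset.univ_nonempty (w r)
    refine ⟨i, hi.symm, ?_⟩
    have h1 := congrFun (hw r hr) i
    rw [followerLaplacian_mulVec] at h1
    simp only [Pi.add_apply, Pi.smul_apply, smul_eq_mul, Pi.one_apply] at h1
    have hi' : w r i = g r := hi.symm
    have h2 : ∑ j : Fin n, adjacency G i.castSucc j.castSucc * (w r i - w r j) ≤ 0 :=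
      Finset.sum_nonpos fun j _ => mul_nonpos_of_nonneg_of_nonpos (adjacency_nonneg _ _)
        (sub_nonpos.2 (hi'.trans_le (Finset.inf'_le _ (Finset.mem_univ j))))
    rw [hi'] at h1 h2
    linarith
  have hg0 : ∀ r ∈ Set.Icc 0 s, g r ≠ 0 := by
    intro r hr h0
    obtain ⟨i, -, hi⟩ := hrow r hr
    rw [h0] at hi; linarith
  have hgpos0 : 0 < g 0 := by
    obtain ⟨i, -, hi⟩ := hrow 0 ⟨le_rfl, hs0⟩
    by_contra hneg
    linarith [mul_nonpos_of_nonneg_of_nonpos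
      (adjacency_nonneg (G := G) i.castSucc (Fin.last n)) (not_lt.1 hneg)]
  have hgpos : 0 < g s := by
    by_contra hneg
    obtain ⟨r, hr, hr0⟩ := intermediate_value_Icc' hs0 hgc ⟨not_lt.1 hneg, hgpos0.le⟩
    exact hg0 r hr hr0
  exact ⟨w s, fun i => hgpos.trans_le (Finset.inf'_le _ (Finset.mem_univ i)),
    hw s ⟨hs0, le_rfl⟩⟩

/-- Weights `w` for the states and `t w` for the estimates that certify the contraction rate `σ` of
the averaging steps of both kinds. -/
theorem exists_weights {ρ γ d : ℝ} (hρ : 0 < ρ) (hd : 0 < d) (hγ : 2 * d + ρ ≤ 2 * γ)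
    (hdeg : ∀ i : Fin n, (neighborCount G i.castSucc : ℝ) ≤ d)
    (h : ∀ r, 0 ≤ r → r < ρ → ∀ w : Fin n → ℝ,
      (followerLaplacian G).mulVec w = r • w → w = 0) :
    ∃ (w : Fin (n + 1) → ℝ) (t σ : ℝ), (∀ i, 0 < w i) ∧ 1 < t ∧ ρ / 2 < σ ∧
      σ * t ≤ γ * (t - 1) ∧ ∀ i : Fin n,
        t * ∑ j, adjacency G i.castSucc j * w j ≤ (neighborCount G i.castSucc - σ) * w i.castSucc := by
  -- both requirements read `ρ / 2 < σ`: `γ (t - 1) / t` exceeds `ρ / 2` when `t > 1 + ρ / (2 d)`,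
  -- and `t s - (t - 1) d` does for `s` close to `ρ` when `t - 1 - ρ / (2 d)` is small enough
  set κ : ℝ := ρ / d with hκ
  have hκ0 : 0 < κ := div_pos hρ hd
  have hρd : ρ = κ * d := by rw [hκ]; field_simp
  set t : ℝ := 1 + κ / 2 + κ ^ 2 / 2 with ht
  have ht1 : 1 < t := by nlinarith
  obtain ⟨s, hs1, hs2⟩ : ∃ s, (1 + κ / 2) * ρ / t < s ∧ s < ρ :=
    exists_between (by rw [div_lt_iff₀ (by linarith)]; nlinarith [sq_nonneg κ, pow_pos hκ0 2])
  have hs0 : 0 ≤ s := le_trans (by positivity) hs1.le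
  rw [div_lt_iff₀ (by linarith)] at hs1
  obtain ⟨w, hw0, hw⟩ := exists_pos_followerLaplacian_mulVec (G := G) hs0
    fun r hr => h r hr.1 (hr.2.trans_lt hs2)
  have hσ1 : ρ / 2 < t * s - (t - 1) * d := by
    rw [ht, hρd] at hs1 ⊢; nlinarith
  have hσ2 : ρ / 2 < γ * (t - 1) / t := by
    rw [lt_div_iff₀ (by linarith)]
    have : (d + ρ / 2) * (t - 1) ≤ γ * (t - 1) :=
      mul_le_mul_of_nonneg_right (by linarith) (by linarith)
    refine lt_of_lt_of_le ?_ this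
    rw [ht, hρd]
    have : 0 < d * κ ^ 2 := by positivity
    nlinarith
  refine ⟨Fin.snoc w 1, t, min (t * s - (t - 1) * d) (γ * (t - 1) / t), fun i => ?_, ht1,
    lt_min hσ1 hσ2, ?_, fun i => ?_⟩
  · refine Fin.lastCases ?_ (fun i => ?_) i
    · simp
    · simpa using hw0 i
  · rw [← le_div_iff₀ (by linarith)]; exact min_le_right _ _
  · have h1 := laplacian_mulVec (G := G) (Fin.snoc w 1 : Fin (n + 1) → ℝ) i.castSucc
    rw [laplacian_mulVec_snoc_castSucc, hw] at h1
    simp only [Pi.add_apply, Pi.smul_apply, smul_eq_mul, Pi.one_apply, mul_one,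
      Fin.snoc_castSucc] at h1 ⊢
    have h2 : -1 ≤ laplacian G i.castSucc (Fin.last n) := by
      simp only [laplacian, adjacency, Matrix.sub_apply, Matrix.of_apply,
        Matrix.diagonal_apply_ne _ (Fin.castSucc_lt_last i).ne]
      split_ifs <;> norm_num
    have h3 : ∑ j, adjacency G i.castSucc j * (Fin.snoc w 1 : Fin (n + 1) → ℝ) j
        ≤ neighborCount G i.castSucc * w i - s * w i := by linarith
    have h4 := mul_le_mul_of_nonneg_left h3 (by linarith : 0 ≤ t)
    have h5 : min (t * s - (t - 1) * d) (γ * (t - 1) / t) * w i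
        ≤ (t * s - (t - 1) * d) * w i :=
      mul_le_mul_of_nonneg_right (min_le_left _ _) (hw0 i).le
    have h6 : (t - 1) * w i * neighborCount G i.castSucc ≤ (t - 1) * w i * d :=
      mul_le_mul_of_nonneg_left (hdeg i) (mul_nonneg (by linarith) (hw0 i).le)
    linarith

end Perron

/-! ### Inequalities for even powers -/

section Inequalities

theorem abs_proj_sub_le {R c : ℝ} (hc : |c| ≤ R) (y : ℝ) : |proj R y - c| ≤ |y - c| := by
  obtain ⟨h1, h2⟩ := abs_le.1 hc
  unfold proj
  split_ifs with h3 h4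
  · rw [abs_of_nonpos (by linarith), abs_of_nonpos (by linarith)]; linarith
  · rw [abs_of_nonneg (by linarith), abs_of_nonneg (by linarith)]; linarith
  · exact le_rfl

theorem abs_proj_le {R : ℝ} (hR : 0 ≤ R) (y : ℝ) : |proj R y| ≤ R := by
  unfold proj
  split_ifs with h3 h4
  · rw [abs_neg, abs_of_nonneg hR]
  · rw [abs_of_nonneg hR]
  · exact abs_le.2 ⟨not_lt.1 h3, not_lt.1 h4⟩

/-- Jensen's inequality for an even power and weights whose sum is at most `S`. -/
theorem pow_sum_mul_le {ι : Type*} (s : Finset ι) (c x : ι → ℝ) {S : ℝ} {p : ℕ} (hp : Even p)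
    (hp0 : 0 < p) (hc : ∀ i ∈ s, 0 ≤ c i) (hS : ∑ i ∈ s, c i ≤ S) :
    (∑ i ∈ s, c i * x i) ^ p ≤ S ^ (p - 1) * ∑ i ∈ s, c i * x i ^ p := by
  set T := ∑ i ∈ s, c i with hT
  have hT0 : 0 ≤ T := Finset.sum_nonneg hc
  have hsum : 0 ≤ ∑ i ∈ s, c i * x i ^ p :=
    Finset.sum_nonneg fun i hi => mul_nonneg (hc i hi) (hp.pow_nonneg _)
  rcases hT0.eq_or_lt with h0 | hpos
  · have hz : ∀ i ∈ s, c i = 0 := (Finset.sum_eq_zero_iff_of_nonneg hc).1 h0.symm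
    rw [Finset.sum_eq_zero fun i hi => by rw [hz i hi, zero_mul], zero_pow hp0.ne']
    exact mul_nonneg (pow_nonneg (hT0.trans hS) _) hsum
  · have h1 := Real.pow_arith_mean_le_arith_mean_pow_of_even s (fun i => c i / T) x
      (fun i hi => div_nonneg (hc i hi) hT0) (by rw [← Finset.sum_div, ← hT, div_self hpos.ne']) hp
    have h2 : ∑ i ∈ s, c i * x i = T * ∑ i ∈ s, c i / T * x i := by
      rw [Finset.mul_sum]; exact Finset.sum_congr rfl fun i _ => by field_simp
    have h3 : ∑ i ∈ s, c i * x i ^ p = T * ∑ i ∈ s, c i / T * x i ^ p := by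
      rw [Finset.mul_sum]; exact Finset.sum_congr rfl fun i _ => by field_simp
    calc (∑ i ∈ s, c i * x i) ^ p = T ^ (p - 1) * (T * (∑ i ∈ s, c i / T * x i) ^ p) := by
          rw [h2, mul_pow, ← mul_assoc, ← pow_succ, Nat.sub_add_cancel hp0]
      _ ≤ T ^ (p - 1) * (T * ∑ i ∈ s, c i / T * x i ^ p) := by gcongr
      _ = T ^ (p - 1) * ∑ i ∈ s, c i * x i ^ p := by rw [h3]
      _ ≤ S ^ (p - 1) * ∑ i ∈ s, c i * x i ^ p := by gcongr

/-- Convexity of an even power, with the weight `τ / p` on the perturbation `b`. -/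
theorem add_pow_le_exp_mul {p : ℕ} (hp : Even p) (hp0 : 0 < p) {τ : ℝ} (hτ : 0 < τ) (a b : ℝ) :
    (a + b) ^ p ≤ Real.exp τ * (a ^ p + (p / τ) ^ (p - 1) * b ^ p) := by
  have hpr : (0 : ℝ) < p := by exact_mod_cast hp0
  set h : ℝ := τ / p with hh
  have hh0 : 0 < h := by positivity
  have h1 := pow_sum_mul_le (Finset.univ : Finset (Fin 2)) ![1, h] ![a, b / h] (S := 1 + h) hp hp0
    (by intro i _; fin_cases i <;> simp [hh0.le]) (by simp)
  simp only [Fin.sum_univ_two, Matrix.cons_val_zero, Matrix.cons_val_one, one_mul] at h1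
  rw [mul_div_cancel₀ _ hh0.ne'] at h1
  have h2 : h * (b / h) ^ p = (p / τ) ^ (p - 1) * b ^ p := by
    obtain ⟨k, rfl⟩ : ∃ k, p = k + 1 := ⟨p - 1, by omega⟩
    rw [show ((k + 1 : ℕ) : ℝ) / τ = 1 / h by rw [hh]; field_simp]
    clear_value h
    rw [Nat.add_sub_cancel, div_pow, div_pow, one_pow, pow_succ h]
    field_simp
  rw [h2] at h1
  refine h1.trans (mul_le_mul_of_nonneg_right ?_ ?_)
  · calc (1 + h) ^ (p - 1) ≤ (1 + h) ^ p := pow_le_pow_right₀ (by linarith) (by omega)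
      _ ≤ (Real.exp h) ^ p := by gcongr; linarith [Real.add_one_le_exp h]
      _ = Real.exp τ := by rw [← Real.exp_nat_mul, hh]; congr 1; field_simp
  · have := hp.pow_nonneg a; have := hp.pow_nonneg b; positivity

/-- Second-order Taylor bound for `(a + b) ^ p`. -/
theorem exists_taylor_pow (p : ℕ) : ∃ C, 0 ≤ C ∧ ∀ a b : ℝ,
    |(a + b) ^ (p + 2) - a ^ (p + 2) - (p + 2) * a ^ (p + 1) * b|
      ≤ C * ((|a| + |b|) ^ p * b ^ 2) := by
  induction p with
  | zero => exact ⟨1, zero_le_one, fun a b => by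
      rw [show (a + b) ^ (0 + 2) - a ^ (0 + 2) - ((0 : ℕ) + 2) * a ^ (0 + 1) * b = b ^ 2 by
        push_cast; ring, abs_of_nonneg (sq_nonneg b)]; simp⟩
  | succ p ih =>
    obtain ⟨C, hC0, hC⟩ := ih
    refine ⟨C + (p + 2), by positivity, fun a b => ?_⟩
    set r := (a + b) ^ (p + 2) - a ^ (p + 2) - (p + 2) * a ^ (p + 1) * b with hr
    have h1 : (a + b) ^ (p + 1 + 2) - a ^ (p + 1 + 2) - ((p + 1 : ℕ) + 2) * a ^ (p + 1 + 1) * b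
        = (a + b) * r + (p + 2) * (a ^ (p + 1) * b ^ 2) := by
      rw [hr]; push_cast; ring
    rw [h1]
    have h2 : |a + b| ≤ |a| + |b| := abs_add_le a b
    have h3 : |a ^ (p + 1) * b ^ 2| ≤ (|a| + |b|) ^ (p + 1) * b ^ 2 := by
      rw [abs_mul, abs_pow, abs_of_nonneg (sq_nonneg b)]
      gcongr
      linarith [abs_nonneg b]
    calc |(a + b) * r + (p + 2) * (a ^ (p + 1) * b ^ 2)|
        ≤ |a + b| * |r| + (p + 2) * |a ^ (p + 1) * b ^ 2| := by
          refine (abs_add_le _ _).trans_eq ?_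
          rw [abs_mul, abs_mul (_ + 2 : ℝ), abs_of_nonneg (by positivity : (0 : ℝ) ≤ p + 2)]
      _ ≤ (|a| + |b|) * (C * ((|a| + |b|) ^ p * b ^ 2))
          + (p + 2) * ((|a| + |b|) ^ (p + 1) * b ^ 2) := by gcongr; exact hC a b
      _ = _ := by ring

theorem young_pow {p : ℕ} {X u : ℝ} (hX : 0 ≤ X) (hu : 0 ≤ u) {η : ℝ} (hη : 0 < η) (hη1 : η ≤ 1) :
    u ^ p * X ^ 2 ≤ η * u ^ (p + 2) + (1 / η) ^ p * X ^ (p + 2) := by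
  have hpos : 0 ≤ η * u ^ (p + 2) := by positivity
  have hpos' : 0 ≤ (1 / η) ^ p * X ^ (p + 2) := by positivity
  rcases le_total X (η * u) with h | h
  · have : u ^ p * X ^ 2 ≤ η * u ^ (p + 2) := by
      calc u ^ p * X ^ 2 ≤ u ^ p * (η * u) ^ 2 := by gcongr
        _ = η * (η * u ^ (p + 2)) := by ring
        _ ≤ 1 * (η * u ^ (p + 2)) := by gcongr
        _ = _ := one_mul _
    linarith
  · have : u ^ p * X ^ 2 ≤ (1 / η) ^ p * X ^ (p + 2) := by
      have h1 : u ≤ 1 / η * X := by rw [one_div, ← div_eq_inv_mul, le_div_iff₀ hη]; linarith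
      calc u ^ p * X ^ 2 ≤ (1 / η * X) ^ p * X ^ 2 := by gcongr
        _ = _ := by ring
    linarith

/-- The effect on an even moment of adding a small perturbation `b = O(τ)`: up to the linear
term, which averages out for a centered `b`, it costs a factor `1 + τ` and `O(τ ^ (1 + p / 2))`. -/
theorem exists_add_pow_le_linear (p : ℕ) (hp : Even p) (hp2 : 2 ≤ p) {B : ℝ} (hB : 0 ≤ B) :
    ∃ C, 0 ≤ C ∧ ∀ τ a b : ℝ, 0 < τ → τ ≤ 1 → |b| ≤ B * τ →
      (a + b) ^ p ≤ (1 + τ) * a ^ p + p * a ^ (p - 1) * b + C * (τ * (Real.sqrt τ) ^ p) := by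
  obtain ⟨q, rfl⟩ : ∃ q, p = q + 2 := ⟨p - 2, by omega⟩
  obtain ⟨C, hC0, hC⟩ := exists_taylor_pow q
  -- `η` absorbs the Taylor constant, the size of the noise and the convexity constant
  set D : ℝ := C * B ^ 2 * 2 ^ (q + 2) with hD
  have hD0 : 0 ≤ D := by positivity
  set η : ℝ := 1 / (D + 1) with hη
  have hη0 : 0 < η := by positivity
  have hη1 : η ≤ 1 := by rw [hη, div_le_one (by linarith)]; linarith
  have hDη : D * η ≤ 1 := by rw [hη, mul_one_div, div_le_one (by linarith)]; linarith
  refine ⟨B ^ (q + 2) + C * B ^ 2 * (1 / η) ^ q, by positivity, fun τ a b hτ hτ1 hb => ?_⟩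
  have h1 := (abs_le.1 (hC a b)).2
  set X := Real.sqrt τ with hX
  have hX0 : 0 ≤ X := Real.sqrt_nonneg _
  have hX2 : X ^ 2 = τ := Real.sq_sqrt hτ.le
  have hX1 : X ≤ 1 := Real.sqrt_le_one.2 hτ1
  have hτX : τ ≤ X := by rw [← hX2]; nlinarith
  have hbX : |b| ≤ B * X := hb.trans (by gcongr)
  have hb2 : b ^ 2 ≤ B ^ 2 * (τ * X ^ 2) := by
    rw [hX2, ← sq_abs]
    calc |b| ^ 2 ≤ (B * τ) ^ 2 := by gcongr
      _ = _ := by ring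
  set u := |a| + |b| with hu
  have hu0 : 0 ≤ u := by positivity
  have hyoung := young_pow (p := q) hX0 hu0 hη0 hη1
  have hup : u ^ (q + 2) ≤ 2 ^ (q + 2) * a ^ (q + 2) + 2 ^ (q + 2) * (B ^ (q + 2) * X ^ (q + 2)) := by
    calc u ^ (q + 2) ≤ 2 ^ (q + 2 - 1) * (|a| ^ (q + 2) + |b| ^ (q + 2)) :=
          add_pow_le (abs_nonneg _) (abs_nonneg _) _
      _ ≤ 2 ^ (q + 2) * (|a| ^ (q + 2) + (B * X) ^ (q + 2)) := by
          gcongr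
          · norm_num
          · omega
      _ = _ := by rw [hp.pow_abs, mul_pow]; ring
  have ha0 : 0 ≤ a ^ (q + 2) := hp.pow_nonneg a
  have h2 : C * (u ^ q * b ^ 2) ≤ τ * a ^ (q + 2)
      + (B ^ (q + 2) + C * B ^ 2 * (1 / η) ^ q) * (τ * X ^ (q + 2)) := by
    calc C * (u ^ q * b ^ 2) ≤ C * (u ^ q * (B ^ 2 * (τ * X ^ 2))) := by gcongr
      _ = C * B ^ 2 * τ * (u ^ q * X ^ 2) := by ring
      _ ≤ C * B ^ 2 * τ * (η * (2 ^ (q + 2) * a ^ (q + 2)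
            + 2 ^ (q + 2) * (B ^ (q + 2) * X ^ (q + 2))) + (1 / η) ^ q * X ^ (q + 2)) := by
          gcongr
          exact hyoung.trans (by gcongr)
      _ = τ * ((D * η) * (a ^ (q + 2) + B ^ (q + 2) * X ^ (q + 2)))
            + C * B ^ 2 * (1 / η) ^ q * (τ * X ^ (q + 2)) := by rw [hD]; ring
      _ ≤ τ * (1 * (a ^ (q + 2) + B ^ (q + 2) * X ^ (q + 2)))
            + C * B ^ 2 * (1 / η) ^ q * (τ * X ^ (q + 2)) := by gcongr
      _ = _ := by ring
  have h3 : ((q + 2 : ℕ) : ℝ) * a ^ (q + 2 - 1) * b = (q + 2) * a ^ (q + 1) * b := by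
    push_cast; rfl
  rw [h3]
  linarith

end Inequalities

/-! ### Polynomial decay from a recursive inequality -/

section Recursion

/-- Discrete Gronwall estimate: a contraction rate `κ / k` with `κ > m` lets inputs of size
`k ^ (-1 - m)` accumulate to `k ^ (-m)` only. -/
theorem exists_rpow_bound_of_recursion {Φ : ℕ → ℝ} {κ m C : ℝ} {K : ℕ} (hm : 0 ≤ m) (hκ : m < κ)
    (hC : 0 ≤ C)
    (h : ∀ k, K ≤ k → Φ (k + 1) ≤ Real.exp (-κ * (1 / ((k : ℝ) + 1))) * Φ k
      + C * (1 / ((k : ℝ) + 1)) ^ (1 + m)) :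
    ∃ D K', 0 ≤ D ∧ ∀ k, K' ≤ k → Φ k ≤ D * (1 / (k : ℝ)) ^ m := by
  set c : ℝ := (κ - m) / 2 with hc
  have hc0 : 0 < c := by rw [hc]; linarith
  obtain ⟨N, hN⟩ := exists_nat_ge (m / c)
  obtain ⟨N', hN'⟩ := exists_nat_ge c
  set K1 := max (max K 1) (max N N') with hK1
  have hK1' : K ≤ K1 ∧ 1 ≤ K1 ∧ N ≤ K1 ∧ N' ≤ K1 := by
    refine ⟨?_, ?_, ?_, ?_⟩ <;> simp [hK1]
  set D := max (Φ K1 * (K1 : ℝ) ^ m) (2 * C / c) with hD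
  have hD1 : Φ K1 * (K1 : ℝ) ^ m ≤ D := le_max_left _ _
  have hD2 : C ≤ D * (c / 2) := by
    have : 2 * C / c ≤ D := le_max_right _ _
    rw [div_le_iff₀ hc0] at this; linarith
  have hD0 : 0 ≤ D := le_trans (by positivity) (le_max_right _ _)
  refine ⟨D, K1, hD0, fun k hk => ?_⟩
  induction k, hk using Nat.le_induction with
  | base =>
    have hK1pos : (0 : ℝ) < K1 := by exact_mod_cast hK1'.2.1
    rw [one_div, Real.inv_rpow hK1pos.le, ← div_eq_mul_inv, le_div_iff₀ (by positivity)]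
    exact hD1
  | succ k hk ih =>
    have hk0 : (0 : ℝ) < k := by exact_mod_cast hK1'.2.1.trans hk
    have hkN : m / c ≤ k := hN.trans (by exact_mod_cast hK1'.2.2.1.trans hk)
    have hkN' : c ≤ k := hN'.trans (by exact_mod_cast hK1'.2.2.2.trans hk)
    set τ : ℝ := 1 / ((k : ℝ) + 1) with hτ
    have hτ0 : 0 < τ := by positivity
    have h1 : (1 / (k : ℝ)) ^ m = (1 + 1 / (k : ℝ)) ^ m * τ ^ m := by
      rw [← Real.mul_rpow (by positivity) hτ0.le]; congr 1; rw [hτ]; field_simp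
    have h2 : (1 + 1 / (k : ℝ)) ^ m ≤ Real.exp (m * (1 / k)) := by
      rw [mul_comm m, Real.exp_mul]
      exact Real.rpow_le_rpow (by positivity) (by linarith [Real.add_one_le_exp (1 / (k : ℝ))]) hm
    have h3 : -κ * τ + m * (1 / k) ≤ -(c * τ) := by
      have : m * (1 / (k : ℝ)) = m * τ + m / k * τ := by rw [hτ]; field_simp
      have h4 : m / k ≤ c := by rw [div_le_iff₀ hk0]; rw [div_le_iff₀ hc0] at hkN; linarith
      have h5 : m / k * τ ≤ c * τ := by gcongr
      have h6 : κ = m + 2 * c := by rw [hc]; ring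
      rw [this, h6]; linarith
    have hcτ : c * τ ≤ 1 := by rw [hτ, mul_one_div, div_le_one (by linarith)]; linarith
    have h4 : Real.exp (-(c * τ)) ≤ 1 - c * τ / 2 := by
      rw [Real.exp_neg, inv_le_comm₀ (Real.exp_pos _) (by linarith)]
      refine le_trans ?_ (Real.add_one_le_exp _)
      rw [inv_le_iff_one_le_mul₀ (by linarith)]
      nlinarith [mul_pos hc0 hτ0]
    have hτm : 0 ≤ τ ^ m := by positivity
    have hcast : (1 / ((k + 1 : ℕ) : ℝ)) = τ := by rw [hτ]; push_cast; rfl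
    rw [hcast]
    calc Φ (k + 1) ≤ Real.exp (-κ * τ) * Φ k + C * τ ^ (1 + m) := h k (hK1'.1.trans hk)
      _ ≤ Real.exp (-κ * τ) * (D * (Real.exp (m * (1 / k)) * τ ^ m)) + C * (τ * τ ^ m) := by
          rw [Real.rpow_add hτ0, Real.rpow_one]
          gcongr
          exact ih.trans (by rw [h1]; gcongr)
      _ = D * τ ^ m * Real.exp (-κ * τ + m * (1 / k)) + C * (τ * τ ^ m) := by
          rw [Real.exp_add]; ring
      _ ≤ D * τ ^ m * (1 - c * τ / 2) + D * (c / 2) * (τ * τ ^ m) := by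
          gcongr
          exact (Real.exp_le_exp.2 h3).trans h4
      _ = D * τ ^ m := by ring

end Recursion

/-! ### The Gaussian distribution function -/

section Gaussian

variable {v : ℝ≥0}

theorem gaussianPDFReal_zero_le_of_abs_le {x y : ℝ} (h : |x| ≤ |y|) :
    gaussianPDFReal 0 v y ≤ gaussianPDFReal 0 v x := by
  have := sq_le_sq.2 h
  simp only [gaussianPDFReal, sub_zero]
  gcongr

theorem cdf_gaussianReal_sub (hv : v ≠ 0) {a b : ℝ} (hab : a ≤ b) :
    cdf (gaussianReal 0 v) b - cdf (gaussianReal 0 v) a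
      = ∫ y in Set.Ioc a b, gaussianPDFReal 0 v y := by
  have hI : ∀ s : Set ℝ, (gaussianReal 0 v).real s = ∫ y in s, gaussianPDFReal 0 v y := fun s => by
    rw [measureReal_def, gaussianReal_apply_eq_integral _ hv, ENNReal.toReal_ofReal]
    exact integral_nonneg fun y => gaussianPDFReal_nonneg _ _ _
  rw [cdf_eq_real, cdf_eq_real, hI, hI, ← Set.Iic_union_Ioc_eq_Iic hab,
    setIntegral_union (Set.Iic_disjoint_Ioc le_rfl) measurableSet_Ioc
      (integrable_gaussianPDFReal _ _).integrableOn (integrable_gaussianPDFReal _ _).integrableOn]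
  ring

theorem cdf_gaussianReal_sub_bounds (hv : v ≠ 0) {a b D : ℝ} (hab : a ≤ b) (ha : |a| ≤ D)
    (hb : |b| ≤ D) :
    gaussianPDFReal 0 v D * (b - a)
        ≤ cdf (gaussianReal 0 v) b - cdf (gaussianReal 0 v) a ∧
      cdf (gaussianReal 0 v) b - cdf (gaussianReal 0 v) a
        ≤ gaussianPDFReal 0 v 0 * (b - a) := by
  rw [cdf_gaussianReal_sub hv hab]
  have hconst : ∀ c : ℝ, ∫ _ in Set.Ioc a b, c = c * (b - a) := fun c => by
    rw [setIntegral_const, Real.volume_real_Ioc_of_le hab, smul_eq_mul, mul_comm]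
  have hint : IntegrableOn (gaussianPDFReal 0 v) (Set.Ioc a b) :=
    (integrable_gaussianPDFReal _ _).integrableOn
  have hcint : ∀ c : ℝ, IntegrableOn (fun _ => c) (Set.Ioc a b) := fun c =>
    integrableOn_const (by simp)
  constructor
  · rw [← hconst]
    refine setIntegral_mono_on (hcint _) hint measurableSet_Ioc fun y hy => ?_
    refine gaussianPDFReal_zero_le_of_abs_le ((abs_le.2 ⟨?_, ?_⟩).trans (le_abs_self D))
    · linarith [(abs_le.1 ha).1, hy.1]
    · linarith [(abs_le.1 hb).2, hy.2]
  · rw [← hconst]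
    exact setIntegral_mono_on hint (hcint _) measurableSet_Ioc fun y _ =>
      gaussianPDFReal_zero_le_of_abs_le (by simp)

/-- Mean value form: the difference quotient of the distribution function lies between the
density at the end of the interval and the density at the center. -/
theorem exists_cdf_gaussianReal_sub_eq (hv : v ≠ 0) {a b D : ℝ} (ha : |a| ≤ D) (hb : |b| ≤ D) :
    ∃ c, gaussianPDFReal 0 v D ≤ c ∧ c ≤ gaussianPDFReal 0 v 0 ∧
      cdf (gaussianReal 0 v) b - cdf (gaussianReal 0 v) a = c * (b - a) := by
  wlog hab : a ≤ b generalizing a b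
  · obtain ⟨c, h1, h2, h3⟩ := this hb ha (le_of_not_ge hab)
    exact ⟨c, h1, h2, by linarith⟩
  rcases hab.eq_or_lt with rfl | hlt
  · exact ⟨_, le_rfl, gaussianPDFReal_zero_le_of_abs_le (by simp), by simp⟩
  · obtain ⟨h1, h2⟩ := cdf_gaussianReal_sub_bounds hv hab ha hb
    have hpos : 0 < b - a := sub_pos.2 hlt
    exact ⟨_, (le_div_iff₀ hpos).2 h1, (div_le_iff₀ hpos).2 h2, (div_mul_cancel₀ _ hpos.ne').symm⟩

end Gaussian

/-! ### Binary observations through independent noise -/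

section Noise


theorem binaryObs_mem (b y : ℝ) : 0 ≤ binaryObs b y ∧ binaryObs b y ≤ 1 := by
  unfold binaryObs; split_ifs <;> norm_num

theorem measurable_binaryObs (b : ℝ) : Measurable (binaryObs b) :=
  Measurable.ite measurableSet_Iic measurable_const measurable_const

/-- A binary observation of `Y` through independent noise has, given the past, the distribution
function of the noise at `b - Y` as its mean. -/
theorem integral_mul_cdf_sub_binaryObs_eq_zero {Ω : Type*} {m mΩ : MeasurableSpace Ω}
    {P : Measure Ω} [IsProbabilityMeasure P] (hm : m ≤ mΩ)
    {g Y ζ : Ω → ℝ} (hg : Measurable[m] g) (hY : Measurable[m] Y) (hζ : Measurable ζ)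
    {μ : Measure ℝ} [IsProbabilityMeasure μ] (hlaw : P.map ζ = μ)
    (hind : Indep (MeasurableSpace.comap ζ inferInstance) m P) {M : ℝ} (hgM : ∀ ω, |g ω| ≤ M)
    (b : ℝ) :
    ∫ ω, g ω * (cdf μ (b - Y ω) - binaryObs b (Y ω + ζ ω)) ∂P = 0 := by
  have hg' : Measurable g := hg.mono hm le_rfl
  have hY' : Measurable Y := hY.mono hm le_rfl
  have hgY : Measurable fun ω => (g ω, Y ω) := hg'.prodMk hY'
  have hindep : IndepFun (fun ω => (g ω, Y ω)) ζ P := by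
    rw [IndepFun_iff_Indep]
    exact (indep_of_indep_of_le_right hind
      (Measurable.comap_le (hg.prodMk hY))).symm
  have hcdf : Measurable (cdf μ) := (monotone_cdf μ).measurable
  have hM : 0 ≤ M := by
    have : Nonempty Ω := nonempty_of_isProbabilityMeasure P
    exact (abs_nonneg _).trans (hgM (Classical.arbitrary Ω))
  have hint1 : Integrable (fun ω => g ω * cdf μ (b - Y ω)) P := by
    refine Integrable.of_bound (C := M) (by fun_prop) (ae_of_all _ fun ω => ?_)
    rw [Real.norm_eq_abs, abs_mul, abs_of_nonneg (cdf_nonneg μ _)]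
    exact (mul_le_mul (hgM ω) (cdf_le_one μ _) (cdf_nonneg μ _) hM).trans_eq (mul_one M)
  have hobs := measurable_binaryObs b
  have hint2 : Integrable (fun ω => g ω * binaryObs b (Y ω + ζ ω)) P := by
    refine Integrable.of_bound (C := M) (by fun_prop) (ae_of_all _ fun ω => ?_)
    have h := binaryObs_mem b (Y ω + ζ ω)
    rw [Real.norm_eq_abs, abs_mul, abs_of_nonneg h.1]
    exact (mul_le_mul (hgM ω) h.2 h.1 hM).trans_eq (mul_one M)
  simp_rw [mul_sub]
  rw [integral_sub hint1 hint2, sub_eq_zero]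
  set f : (ℝ × ℝ) × ℝ → ℝ := fun z => z.1.1 * binaryObs b (z.1.2 + z.2) with hf
  have hfm : Measurable f := by fun_prop
  have hmap : P.map (fun ω => ((g ω, Y ω), ζ ω)) = (P.map fun ω => (g ω, Y ω)).prod μ := by
    rw [← hlaw]
    exact (indepFun_iff_map_prod_eq_prod_map_map hgY.aemeasurable hζ.aemeasurable).1 hindep
  have hpair : Measurable fun ω => ((g ω, Y ω), ζ ω) := hgY.prodMk hζ
  have : IsProbabilityMeasure (P.map fun ω => (g ω, Y ω)) :=
    Measure.isProbabilityMeasure_map hgY.aemeasurable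
  have hfint : Integrable f ((P.map fun ω => (g ω, Y ω)).prod μ) := by
    rw [← hmap, integrable_map_measure hfm.aestronglyMeasurable hpair.aemeasurable]
    exact hint2
  have hinner : ∀ y : ℝ × ℝ, ∫ z, f (y, z) ∂μ = y.1 * cdf μ (b - y.2) := fun y => by
    simp only [hf]
    rw [integral_const_mul, cdf_eq_real]
    congr 1
    rw [← integral_indicator_one measurableSet_Iic]
    refine integral_congr_ae (ae_of_all _ fun z => ?_)
    simp only [binaryObs, Set.indicator, Set.mem_Iic, Pi.one_apply]
    congr 1
    rw [le_sub_iff_add_le, add_comm]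
  calc ∫ ω, g ω * cdf μ (b - Y ω) ∂P
      = ∫ y, y.1 * cdf μ (b - y.2) ∂(P.map fun ω => (g ω, Y ω)) := by
        rw [integral_map hgY.aemeasurable (by fun_prop)]
    _ = ∫ y, ∫ z, f (y, z) ∂μ ∂(P.map fun ω => (g ω, Y ω)) := by simp_rw [hinner]
    _ = ∫ z, f z ∂((P.map fun ω => (g ω, Y ω)).prod μ) := (integral_prod f hfint).symm
    _ = ∫ ω, g ω * binaryObs b (Y ω + ζ ω) ∂P := by
        rw [← hmap, integral_map hpair.aemeasurable hfm.aestronglyMeasurable]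

end Noise

/-! ### One averaging step in powers of the weighted deviations -/

section Steps

/-- A control step averages the own deviation `δ` and the estimates `z`; in the weights `w`, `t w`
the coefficients of this average sum to at most `1 - σ τ`. -/
theorem follower_step {V : Type*} (N : Finset V) {p : ℕ} (hp : Even p) (hp0 : 0 < p)
    {τ σ t wi c : ℝ} {w : V → ℝ} (hτ : 0 < τ) (ht : 0 < t) (hwi : 0 < wi) (hw : ∀ j, 0 < w j)
    (hc : ∀ j, t * w j / wi ≤ c) (hdτ : N.card * τ ≤ 1)
    (hσ : t * ∑ j ∈ N, w j ≤ (N.card - σ) * wi) (δ f : ℝ) (z : V → ℝ) :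
    ((δ - τ * ∑ j ∈ N, (δ - z j) - f) / wi) ^ p ≤
      Real.exp τ * (Real.exp (-(σ * (p - 1 : ℕ) * τ)) *
        ((δ / wi) ^ p + τ * (c * ∑ j ∈ N, (z j / (t * w j)) ^ p))
        + (p / τ) ^ (p - 1) * (f / wi) ^ p) := by
  set a : ℝ := (1 - N.card * τ) * (δ / wi) + ∑ j ∈ N, τ * (t * w j / wi) * (z j / (t * w j)) with ha
  have hsplit : (δ - τ * ∑ j ∈ N, (δ - z j) - f) / wi = a + -(f / wi) := by
    have h1 : ∑ j ∈ N, τ * (t * w j / wi) * (z j / (t * w j)) = τ * (∑ j ∈ N, z j) / wi := by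
      rw [Finset.mul_sum, Finset.sum_div]
      refine Finset.sum_congr rfl fun j _ => ?_
      have := hw j
      field_simp
    rw [ha, h1, Finset.sum_sub_distrib, Finset.sum_const, nsmul_eq_mul]
    field_simp
    ring
  rw [hsplit]
  refine (add_pow_le_exp_mul hp hp0 hτ _ _).trans ?_
  rw [hp.neg_pow]
  have hwt : ∀ j, 0 ≤ t * w j / wi := fun j => by have := hw j; positivity
  -- `none` stands for the follower itself, `some j` for its estimate of `j`
  have hJ := pow_sum_mul_le (Finset.insertNone N)
    (fun o => o.elim (1 - N.card * τ) fun j => τ * (t * w j / wi))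
    (fun o => o.elim (δ / wi) fun j => z j / (t * w j)) (S := Real.exp (-(σ * τ))) hp hp0
    (by
      intro o _
      cases o with
      | none => simpa using hdτ
      | some j => exact mul_nonneg hτ.le (hwt j))
    (by
      simp only [Finset.sum_insertNone, Option.elim]
      have h1 : ∑ j ∈ N, τ * (t * w j / wi) = τ * ((t * ∑ j ∈ N, w j) / wi) := by
        rw [← Finset.mul_sum, Finset.mul_sum N w t, Finset.sum_div]
      have h2 : (t * ∑ j ∈ N, w j) / wi ≤ N.card - σ := by rwa [div_le_iff₀ hwi]
      rw [h1]
      have h3 := mul_le_mul_of_nonneg_left h2 hτ.le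
      linarith [Real.add_one_le_exp (-(σ * τ))])
  simp only [Finset.sum_insertNone, Option.elim] at hJ
  rw [← ha, ← Real.exp_nat_mul] at hJ
  have hexp : ((p - 1 : ℕ) : ℝ) * -(σ * τ) = -(σ * (p - 1 : ℕ) * τ) := by ring
  rw [hexp] at hJ
  gcongr
  refine hJ.trans ?_
  gcongr
  · exact mul_le_of_le_one_left (hp.pow_nonneg _) (by
      have : (0 : ℝ) ≤ N.card * τ := by positivity
      linarith)
  · rw [Finset.mul_sum, Finset.mul_sum]
    refine Finset.sum_le_sum fun j _ => ?_
    rw [mul_assoc]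
    have := hp.pow_nonneg (z j / (t * w j))
    gcongr
    exact hc j

/-- The estimation step without its noise averages the estimate `z` and the deviation `δ` of the
observed neighbor, with the slope hidden in `θ`; as the estimate has the larger weight `t w_j`, the
weighted coefficients sum to at most `1 - σ τ` for every admissible `θ`. -/
theorem estimate_step {p : ℕ} (hp : Even p) (hp0 : 0 < p) {τ σ t wj γ Γ θ : ℝ} (hτ : 0 < τ)
    (ht : 1 < t) (hwj : 0 < wj) (hγ : 0 < γ) (hθ : γ * τ ≤ θ) (hθΓ : θ ≤ Γ * τ) (hθ1 : θ ≤ 1)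
    (hσ : σ * t ≤ γ * (t - 1)) (z δ e : ℝ) :
    (((1 - θ) * z + θ * δ + e) / (t * wj)) ^ p ≤
      Real.exp τ * (Real.exp (-(σ * (p - 1 : ℕ) * τ)) *
        ((z / (t * wj)) ^ p + τ * (Γ * (δ / wj) ^ p))
        + (p / τ) ^ (p - 1) * (e / (t * wj)) ^ p) := by
  have ht0 : 0 < t := by linarith
  have hθ0 : 0 ≤ θ := le_trans (by positivity) hθ
  rw [add_div]
  refine (add_pow_le_exp_mul hp hp0 hτ _ _).trans ?_
  have hJ := pow_sum_mul_le (Finset.univ : Finset (Fin 2)) ![1 - θ, θ / t]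
    ![z / (t * wj), δ / wj] (S := Real.exp (-(σ * τ))) hp hp0
    (by
      intro i _
      fin_cases i
      · simpa using hθ1
      · simpa using div_nonneg hθ0 ht0.le)
    (by
      simp only [Fin.sum_univ_two, Matrix.cons_val_zero, Matrix.cons_val_one]
      have h1 : σ * τ ≤ θ * ((t - 1) / t) := by
        have h2 : σ ≤ γ * ((t - 1) / t) := by
          rw [← mul_div_assoc, le_div_iff₀ ht0]; exact hσ
        have h3 : 0 ≤ (t - 1) / t := div_nonneg (by linarith) ht0.le
        calc σ * τ ≤ γ * ((t - 1) / t) * τ := by gcongr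
          _ = γ * τ * ((t - 1) / t) := by ring
          _ ≤ _ := by gcongr
      have h2 : θ * ((t - 1) / t) = θ - θ / t := by field_simp
      linarith [Real.add_one_le_exp (-(σ * τ))])
  simp only [Fin.sum_univ_two, Matrix.cons_val_zero, Matrix.cons_val_one] at hJ
  have hsplit : ((1 - θ) * z + θ * δ) / (t * wj)
      = (1 - θ) * (z / (t * wj)) + θ / t * (δ / wj) := by field_simp
  rw [hsplit]
  rw [← Real.exp_nat_mul] at hJ
  have hexp : ((p - 1 : ℕ) : ℝ) * -(σ * τ) = -(σ * (p - 1 : ℕ) * τ) := by ring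
  rw [hexp] at hJ
  gcongr
  refine hJ.trans ?_
  have hu := hp.pow_nonneg (δ / wj)
  have hθt : θ / t ≤ τ * Γ := (div_le_self hθ0 ht.le).trans (hθΓ.trans_eq (mul_comm _ _))
  rw [← mul_assoc τ Γ]
  gcongr
  exact mul_le_of_le_one_left (hp.pow_nonneg _) (by linarith)

theorem perturbation_pow_le {p : ℕ} (hp : Even p) (hp0 : 0 < p) {τ C ε m e : ℝ} (hτ : 0 < τ)
    (hτ1 : τ ≤ 1) (hC : 0 ≤ C) (he : |e| ≤ C * τ ^ (1 + ε)) (hm : m ≤ p * ε) :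
    (p / τ) ^ (p - 1) * e ^ p ≤ p ^ (p - 1) * C ^ p * τ ^ (1 + m) := by
  have h1 : e ^ p ≤ (C * τ ^ (1 + ε)) ^ p := by rw [← hp.pow_abs]; gcongr
  have h2 : (τ ^ (1 + ε)) ^ p = τ ^ (p - 1) * τ ^ (1 + p * ε) := by
    rw [← Real.rpow_natCast, ← Real.rpow_mul hτ.le, ← Real.rpow_natCast τ (p - 1),
      ← Real.rpow_add hτ, Nat.cast_sub hp0]
    congr 1; push_cast; ring
  calc (p / τ) ^ (p - 1) * e ^ p ≤ (p / τ) ^ (p - 1) * (C * τ ^ (1 + ε)) ^ p := by gcongr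
    _ = p ^ (p - 1) * C ^ p * τ ^ (1 + p * ε) := by
        rw [mul_pow, h2, div_pow]; field_simp
    _ ≤ p ^ (p - 1) * C ^ p * τ ^ (1 + m) := by
        gcongr ?_ * ?_
        exact Real.rpow_le_rpow_of_exponent_ge hτ hτ1 (by linarith)

theorem mul_sqrt_pow_le {p : ℕ} {τ m : ℝ} (hτ : 0 < τ) (hτ1 : τ ≤ 1) (hm : m ≤ p / 2) :
    τ * Real.sqrt τ ^ p ≤ τ ^ (1 + m) := by
  rw [Real.sqrt_eq_rpow, ← Real.rpow_natCast, ← Real.rpow_mul hτ.le]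
  nth_rewrite 1 [← Real.rpow_one τ]
  rw [← Real.rpow_add hτ]
  exact Real.rpow_le_rpow_of_exponent_ge hτ hτ1 (by linarith)

theorem one_div_rpow_le {ε : ℝ} (hε0 : 0 < ε) (hε1 : ε < 1) {k : ℕ} (hk : 1 ≤ k) :
    1 / (k : ℝ) ^ (1 + ε) ≤ 4 * (1 / ((k : ℝ) + 1)) ^ (1 + ε) := by
  have hk0 : (1 : ℝ) ≤ k := by exact_mod_cast hk
  have h1 : 1 / (k : ℝ) ^ (1 + ε) = (1 / (k : ℝ)) ^ (1 + ε) := by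
    rw [one_div, one_div, Real.inv_rpow (by linarith)]
  have h2 : 1 / (k : ℝ) ≤ 2 * (1 / ((k : ℝ) + 1)) := by
    rw [mul_one_div, div_le_div_iff₀ (by linarith) (by linarith)]; linarith
  rw [h1]
  calc (1 / (k : ℝ)) ^ (1 + ε) ≤ (2 * (1 / ((k : ℝ) + 1))) ^ (1 + ε) := by gcongr
    _ = 2 ^ (1 + ε) * (1 / ((k : ℝ) + 1)) ^ (1 + ε) := by
        rw [Real.mul_rpow (by norm_num) (by positivity)]
    _ ≤ 2 ^ (2 : ℝ) * (1 / ((k : ℝ) + 1)) ^ (1 + ε) := by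
        gcongr
        · norm_num
        · linarith
    _ = _ := by norm_num

end Steps

/-! ### Bounds on the trajectories -/

section Trajectories

variable {n : ℕ} {Ω : Type*} [MeasurableSpace Ω] {G : Digraph (Fin (n + 1))} [DecidableRel G.Adj]
  {f : ℕ → ℝ} {R β : ℝ} {F : ℝ → ℝ} {thr : Fin n → Fin (n + 1) → ℝ}
  {x : ℕ → Fin (n + 1) → Ω → ℝ} {xhat ξ : ℕ → Fin n → Fin (n + 1) → Ω → ℝ}

/-- The neighbors of the follower `i`. -/
def neighbors (G : Digraph (Fin (n + 1))) [DecidableRel G.Adj] (i : Fin n) :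
    Finset (Fin (n + 1)) :=
  Finset.univ.filter fun j => G.Adj j i.castSucc

@[simp] theorem mem_neighbors {i : Fin n} {j : Fin (n + 1)} :
    j ∈ neighbors G i ↔ G.Adj j i.castSucc := by simp [neighbors]

theorem card_neighbors (i : Fin n) : (neighbors G i).card = neighborCount G i.castSucc := rfl

theorem sum_adjacency_mul (i : Fin n) (y : Fin (n + 1) → ℝ) :
    ∑ j, adjacency G i.castSucc j * y j = ∑ j ∈ neighbors G i, y j := by
  simp [adjacency, neighbors, Finset.sum_filter]

theorem neighborCount_le_maxNeighborCount (i : Fin n) :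
    neighborCount G i.castSucc ≤ maxNeighborCount G :=
  Finset.le_sup (f := fun i : Fin n => neighborCount G i.castSucc) (Finset.mem_univ i)

theorem neighborCount_pos (htree : HasDirectedSpanningTree G (Fin.last n)) (i : Fin n) :
    0 < neighborCount G i.castSucc := by
  obtain ⟨T, hTG, hT⟩ := htree
  obtain ⟨j, hj, -⟩ := hT.parent i.castSucc (Fin.castSucc_lt_last i).ne
  exact Finset.card_pos.2 ⟨j, by simpa using hTG _ _ hj⟩

theorem neighborCount_le (i : Fin (n + 1)) : neighborCount G i ≤ n + 1 :=
  (Finset.card_le_univ _).trans_eq (by simp)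

namespace IsCRS

theorem bound_nonneg (h : IsCRS G f R β F thr x xhat ξ) (ω : Ω) : 0 ≤ R :=
  (abs_nonneg _).trans (h.leader_bound 0 ω)

theorem control_eq (h : IsCRS G f R β F thr x xhat ξ) (k : ℕ) (i : Fin n) (ω : Ω) :
    x (k + 1) i.castSucc ω = x k i.castSucc ω
      - 1 / ((k : ℝ) + 1) * ∑ j ∈ neighbors G i, (x k i.castSucc ω - xhat k i j ω) := by
  rw [h.control, sum_adjacency_mul]

theorem abs_estimate_le (h : IsCRS G f R β F thr x xhat ξ) (k : ℕ) {i : Fin n} {j : Fin (n + 1)}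
    (hij : G.Adj j i.castSucc) (ω : Ω) : |xhat k i j ω| ≤ R := by
  rcases Nat.eq_zero_or_pos k with rfl | hk
  · exact h.init_estimate i j ω hij
  · rw [h.estimate k i j ω hk hij]
    exact abs_proj_le (h.bound_nonneg ω) _

/-- At time `d_i` the gain `1 / d_i` erases the own state, so that the state of follower `i`
becomes an average of projected estimates; from then on it is a convex combination. -/
theorem abs_follower_le (h : IsCRS G f R β F thr x xhat ξ) {i : Fin n}
    (hi : 0 < neighborCount G i.castSucc) {k : ℕ} (hk : neighborCount G i.castSucc ≤ k) (ω : Ω) :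
    |x k i.castSucc ω| ≤ R := by
  -- the follower's state after a step with gain `1 / (k + 1) ≤ 1 / d_i`
  have hstep : ∀ k : ℕ, neighborCount G i.castSucc ≤ k + 1 →
      |x (k + 1) i.castSucc ω| ≤ (1 - neighborCount G i.castSucc / ((k : ℝ) + 1))
        * |x k i.castSucc ω| + neighborCount G i.castSucc / ((k : ℝ) + 1) * R := by
    intro k hk
    have hk' : (neighborCount G i.castSucc : ℝ) ≤ (k : ℝ) + 1 := by exact_mod_cast hk
    have hpos : (0 : ℝ) < (k : ℝ) + 1 := by positivity
    have h1 : x (k + 1) i.castSucc ω = (1 - neighborCount G i.castSucc / ((k : ℝ) + 1))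
        * x k i.castSucc ω + 1 / ((k : ℝ) + 1) * ∑ j ∈ neighbors G i, xhat k i j ω := by
      rw [h.control_eq, Finset.sum_sub_distrib, Finset.sum_const, nsmul_eq_mul, card_neighbors]
      ring
    have h2 : |∑ j ∈ neighbors G i, xhat k i j ω| ≤ neighborCount G i.castSucc * R := by
      refine (Finset.abs_sum_le_sum_abs _ _).trans ?_
      refine (Finset.sum_le_card_nsmul _ _ R fun j hj =>
        h.abs_estimate_le k (mem_neighbors.1 hj) ω).trans_eq ?_
      rw [nsmul_eq_mul, card_neighbors]
    rw [h1]
    refine (abs_add_le _ _).trans ?_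
    rw [abs_mul, abs_mul, abs_of_nonneg (a := 1 - _) (by
      rw [sub_nonneg, div_le_one hpos]; exact hk'), abs_of_pos (one_div_pos.2 hpos)]
    have h3 := mul_le_mul_of_nonneg_left h2 (one_div_pos.2 hpos).le
    have h4 : 1 / ((k : ℝ) + 1) * (neighborCount G i.castSucc * R)
        = neighborCount G i.castSucc / ((k : ℝ) + 1) * R := by ring
    linarith
  induction k, hk using Nat.le_induction with
  | base =>
    obtain ⟨m, hm⟩ : ∃ m, neighborCount G i.castSucc = m + 1 := ⟨_, (Nat.sub_add_cancel hi).symm⟩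
    have h1 := hstep m hm.le
    rw [hm] at h1 ⊢
    have h2 : ((m + 1 : ℕ) : ℝ) / ((m : ℝ) + 1) = 1 := by
      push_cast; exact div_self (by positivity)
    rw [h2] at h1
    linarith
  | succ k hk ih =>
    refine (hstep k (hk.trans (Nat.le_succ k))).trans ?_
    have hk' : (neighborCount G i.castSucc : ℝ) ≤ (k : ℝ) + 1 := by
      exact_mod_cast hk.trans (Nat.le_succ k)
    have h1 : 0 ≤ 1 - neighborCount G i.castSucc / ((k : ℝ) + 1) := by
      rw [sub_nonneg, div_le_one (by positivity)]; exact hk'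
    have h2 := mul_le_mul_of_nonneg_left ih h1
    linarith

theorem abs_state_le (h : IsCRS G f R β F thr x xhat ξ)
    (hpos : ∀ i : Fin n, 0 < neighborCount G i.castSucc) {k : ℕ} (hk : n + 1 ≤ k)
    (i : Fin (n + 1)) (ω : Ω) : |x k i ω| ≤ R := by
  refine Fin.lastCases ?_ (fun i => ?_) i
  · exact h.leader_bound k ω
  · exact h.abs_follower_le (hpos i) ((neighborCount_le _).trans hk) ω

theorem exists_abs_state_le (h : IsCRS G f R β F thr x xhat ξ) (k : ℕ) (i : Fin (n + 1)) :
    ∃ C, ∀ ω, |x k i ω| ≤ C := by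
  refine Fin.lastCases ⟨R, h.leader_bound k⟩ (fun i => ?_) i
  induction k with
  | zero => exact ⟨R, h.init_state i⟩
  | succ k ih =>
    obtain ⟨C, hC⟩ := ih
    refine ⟨C + 1 / ((k : ℝ) + 1) * ((neighbors G i).card • (C + R)), fun ω => ?_⟩
    rw [h.control_eq]
    refine (abs_sub _ _).trans (add_le_add (hC ω) ?_)
    rw [abs_mul, abs_of_nonneg (by positivity : (0 : ℝ) ≤ 1 / ((k : ℝ) + 1))]
    gcongr
    refine (Finset.abs_sum_le_sum_abs _ _).trans (Finset.sum_le_card_nsmul _ _ _ fun j hj => ?_)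
    exact (abs_sub _ _).trans (add_le_add (hC ω) (h.abs_estimate_le k (mem_neighbors.1 hj) ω))

end IsCRS
end Trajectories

/-! ### From even moments to mean-square rates -/

section MeanSquare
variable {Ω : Type*} [MeasurableSpace Ω] {P : Measure Ω}

theorem integrable_pow_of_bounded [IsProbabilityMeasure P] {g : Ω → ℝ} (hg : Measurable g)
    (hb : ∃ C, ∀ ω, |g ω| ≤ C)
    (p : ℕ) : Integrable (fun ω => g ω ^ p) P := by
  obtain ⟨C, hC⟩ := hb
  refine Integrable.of_bound (C := C ^ p) (hg.pow_const p).aestronglyMeasurable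
    (ae_of_all _ fun ω => ?_)
  rw [Real.norm_eq_abs, abs_pow]
  exact pow_le_pow_left₀ (abs_nonneg _) (hC ω) p

/-- A decay rate of an even moment of order `2 r` gives the corresponding rate of the mean square. -/
theorem integral_sq_le_of_moment [IsProbabilityMeasure P] {g : Ω → ℝ} {r : ℕ} (hr : 0 < r)
    {a D s : ℝ} (ha : 0 < a)
    (h2 : Integrable (fun ω => g ω ^ 2) P) (h2r : Integrable (fun ω => g ω ^ (2 * r)) P)
    (h : ∫ ω, g ω ^ (2 * r) ∂P ≤ D * a ^ (r * s)) :
    ∫ ω, g ω ^ 2 ∂P ≤ (1 + D) * a ^ s := by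
  have has : 0 < a ^ s := by positivity
  have hpt : ∀ ω, g ω ^ 2 ≤ a ^ s + a ^ s / a ^ (r * s) * g ω ^ (2 * r) := by
    intro ω
    have hy : 0 ≤ g ω ^ 2 / a ^ s := by positivity
    -- `y ≤ 1 + y ^ r` after scaling by the target rate
    have h1 : g ω ^ 2 / a ^ s ≤ 1 + (g ω ^ 2 / a ^ s) ^ r := by
      rcases le_total (g ω ^ 2 / a ^ s) 1 with h | h
      · have := pow_nonneg hy r; linarith
      · have := le_self_pow₀ h hr.ne'; linarith
    rw [div_le_iff₀ has] at h1
    refine h1.trans_eq ?_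
    rw [div_pow, ← pow_mul, mul_comm (r : ℝ) s, Real.rpow_mul ha.le, Real.rpow_natCast]
    ring
  have h3 : ∫ ω, g ω ^ 2 ∂P ≤ ∫ ω, (a ^ s + a ^ s / a ^ (r * s) * g ω ^ (2 * r)) ∂P :=
    integral_mono h2 ((integrable_const _).add (h2r.const_mul _)) hpt
  rw [integral_add (integrable_const _) (h2r.const_mul _), integral_const_mul, integral_const,
    probReal_univ, one_smul] at h3
  have h4 := mul_le_mul_of_nonneg_left h (div_nonneg has.le (by positivity : 0 ≤ a ^ (r * s)))
  have h5 : a ^ s / a ^ (r * s) * (D * a ^ (r * s)) = D * a ^ s := by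
    field_simp
  linarith

theorem hasThreeCaseRate_of_bound {Z : ℕ → Ω → ℝ} {ε ρ D : ℝ} (hZ : ∀ k, MemLp (Z k) 2 P)
    {K : ℕ} (h : ∀ k, K ≤ k → ∫ ω, Z k ω ^ 2 ∂P ≤ D * (1 / (k : ℝ)) ^ min ρ ε) :
    HasThreeCaseRate P Z ε ρ := by
  have hpow : ∀ (k : ℕ) (s : ℝ), (1 / (k : ℝ)) ^ s = 1 / (k : ℝ) ^ s := fun k s => by
    rw [Real.div_rpow zero_le_one (Nat.cast_nonneg k), Real.one_rpow]
  have hO : (fun k => ∫ ω, Z k ω ^ 2 ∂P) =O[atTop] fun k : ℕ => 1 / (k : ℝ) ^ min ρ ε := by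
    refine IsBigO.of_bound D ?_
    filter_upwards [eventually_ge_atTop K] with k hk
    rw [Real.norm_of_nonneg (integral_nonneg fun ω => sq_nonneg _),
      Real.norm_of_nonneg (by positivity), ← hpow]
    exact h k hk
  refine ⟨fun hlt => ⟨hZ, ?_⟩, fun heq => ⟨hZ, ?_⟩, fun hlt => ⟨hZ, ?_⟩⟩
  · rwa [min_eq_left hlt.le] at hO
  · rw [← heq, min_self] at hO
    refine hO.trans (IsBigO.of_bound 1 ?_)
    filter_upwards [eventually_ge_atTop 3] with k hk
    have hlog : 1 ≤ Real.log k := by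
      rw [Real.le_log_iff_exp_le (by positivity)]
      have : (3 : ℝ) ≤ k := by exact_mod_cast hk
      linarith [Real.exp_one_lt_d9]
    rw [one_mul, Real.norm_of_nonneg (by positivity), Real.norm_of_nonneg (by positivity)]
    gcongr
  · rwa [min_eq_right hlt.le] at hO

end MeanSquare

/-! ### Measurability with respect to the history -/

section History
variable {n : ℕ} {Ω : Type*} {G : Digraph (Fin (n + 1))}
  {x : ℕ → Fin (n + 1) → Ω → ℝ} {xhat : ℕ → Fin n → Fin (n + 1) → Ω → ℝ}

theorem measurable_history_state {l k : ℕ} (hl : l ≤ k) (i : Fin (n + 1)) :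
    Measurable[history G x xhat k] (x l i) :=
  measurable_iff_comap_le.2
    (le_sup_of_le_left (le_iSup₂_of_le l hl (le_iSup_of_le i le_rfl)))

theorem measurable_history_estimate {l k : ℕ} (hl : l < k) {i : Fin n} {j : Fin (n + 1)}
    (hij : G.Adj j i.castSucc) : Measurable[history G x xhat k] (xhat l i j) :=
  measurable_iff_comap_le.2 (le_sup_of_le_right (le_iSup₂_of_le l hl
    (le_iSup_of_le i (le_iSup₂_of_le j hij le_rfl))))

theorem history_le [mΩ : MeasurableSpace Ω] (hx : ∀ k i, Measurable (x k i))
    (hxhat : ∀ k i j, G.Adj j i.castSucc → Measurable (xhat k i j)) (k : ℕ) :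
    history G x xhat k ≤ mΩ :=
  sup_le (iSup₂_le fun l _ => iSup_le fun i => (hx l i).comap_le)
    (iSup₂_le fun l _ => iSup_le fun i => iSup₂_le fun j hij => (hxhat l i j hij).comap_le)

end History

/-! ### Moments of the estimates -/

section MomentRecursion

variable {n : ℕ} {Ω : Type*} [MeasurableSpace Ω] {P : Measure Ω} [IsProbabilityMeasure P]
  {G : Digraph (Fin (n + 1))} [DecidableRel G.Adj] {R β ε : ℝ} {v : ℝ≥0}
  {thr : Fin n → Fin (n + 1) → ℝ}
  {x : ℕ → Fin (n + 1) → Ω → ℝ} {xhat ξ : ℕ → Fin n → Fin (n + 1) → Ω → ℝ}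

/-- Apart from the increment `f k` of the leader, a deviation changes by `O(1 / k)` in one step. -/
theorem IsCRS.abs_error_succ_sub_le {f : ℕ → ℝ} {F : ℝ → ℝ} (h : IsCRS G f R β F thr x xhat ξ)
    (hpos : ∀ i : Fin n, 0 < neighborCount G i.castSucc) {k : ℕ} (hk : n + 1 ≤ k)
    (j : Fin (n + 1)) (ω : Ω) :
    |(x (k + 1) j ω - x (k + 1) (Fin.last n) ω) - (x k j ω - x k (Fin.last n) ω) + f k|
      ≤ |f k| + (1 / ((k : ℝ) + 1)) * ((n + 1) * (2 * R)) := by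
  have hR := h.bound_nonneg ω
  have hl := h.leader k ω (by omega)
  refine Fin.lastCases ?_ (fun j => ?_) j
  · have : 0 ≤ (1 / ((k : ℝ) + 1)) * ((n + 1) * (2 * R)) := by positivity
    simp only [sub_self, zero_add]; linarith
  · rw [h.control_eq, hl]
    have h1 : |∑ l ∈ neighbors G j, (x k j.castSucc ω - xhat k j l ω)| ≤ (n + 1) * (2 * R) := by
      refine (Finset.abs_sum_le_sum_abs _ _).trans ?_
      refine (Finset.sum_le_card_nsmul _ _ (2 * R) fun l hl => ?_).trans ?_
      · have h2 := h.abs_state_le hpos hk j.castSucc ω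
        have h3 := h.abs_estimate_le k (mem_neighbors.1 hl) ω
        exact (abs_sub _ _).trans (by linarith)
      · rw [nsmul_eq_mul, card_neighbors]
        gcongr
        exact_mod_cast neighborCount_le _
    set S := ∑ l ∈ neighbors G j, (x k j.castSucc ω - xhat k j l ω)
    have h2 : x k j.castSucc ω - 1 / ((k : ℝ) + 1) * S - (x k (Fin.last n) ω + f k)
        - (x k j.castSucc ω - x k (Fin.last n) ω) + f k = -(1 / ((k : ℝ) + 1) * S) := by ring
    rw [h2, abs_neg, abs_mul, abs_of_pos (by positivity : (0 : ℝ) < 1 / ((k : ℝ) + 1))]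
    have := mul_le_mul_of_nonneg_left h1 (by positivity : (0 : ℝ) ≤ 1 / ((k : ℝ) + 1))
    linarith [abs_nonneg (f k)]

theorem integral_le_of_le_add {g g₁ g₂ : Ω → ℝ} {c₁ c₂ b : ℝ} (hg : Integrable g P)
    (h₁ : Integrable g₁ P) (h₂ : Integrable g₂ P)
    (h : ∀ ω, g ω ≤ c₁ * g₁ ω + c₂ * g₂ ω + b) :
    ∫ ω, g ω ∂P ≤ c₁ * ∫ ω, g₁ ω ∂P + c₂ * ∫ ω, g₂ ω ∂P + b := by
  have h12 : Integrable (fun ω => c₁ * g₁ ω + c₂ * g₂ ω) P := (h₁.const_mul _).add (h₂.const_mul _)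
  refine (integral_mono hg (h12.add (integrable_const b)) h).trans_eq ?_
  rw [integral_add' h12 (integrable_const _), integral_add (h₁.const_mul _) (h₂.const_mul _),
    integral_const_mul, integral_const_mul, integral_const, probReal_univ, one_smul]

/-- The noise enters the moment only to second order, since it is centered given the history. -/
theorem IsCRS.estimate_moment_step
    (h : IsCRS G (fun k => 1 / (k : ℝ) ^ (1 + ε)) R β (fun y => cdf (gaussianReal 0 v) y)
      thr x xhat ξ) (hnoise : IsLinkNoise G P v x xhat ξ) (hv : v ≠ 0) (hε0 : 0 < ε) (hε1 : ε < 1)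
    (hβ : 0 < β) (hpos : ∀ i : Fin n, 0 < neighborCount G i.castSucc) {D t σ wj m : ℝ}
    (ht : 1 < t) (hwj : 0 < wj) (hσ : σ * t ≤ β * gaussianPDFReal 0 v D * (t - 1)) {p : ℕ}
    (hp : Even p) (hp2 : 2 ≤ p) (hm1 : m ≤ p / 2) (hm2 : m ≤ p * ε) {i : Fin n}
    {j : Fin (n + 1)} (hij : G.Adj j i.castSucc) (hthr : |thr i j| + R ≤ D) :
    ∃ C, 0 ≤ C ∧ ∀ k : ℕ, n + 1 ≤ k → β * gaussianPDFReal 0 v 0 * (1 / ((k : ℝ) + 1)) ≤ 1 →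
      ∫ ω, ((xhat (k + 1) i j ω - x (k + 1) (Fin.last n) ω) / (t * wj)) ^ p ∂P
        ≤ Real.exp (2 * (1 / ((k : ℝ) + 1)) - σ * (p - 1 : ℕ) * (1 / ((k : ℝ) + 1))) *
          (∫ ω, ((xhat k i j ω - x k (Fin.last n) ω) / (t * wj)) ^ p ∂P
            + (1 / ((k : ℝ) + 1)) * (β * gaussianPDFReal 0 v 0 *
              ∫ ω, ((x k j ω - x k (Fin.last n) ω) / wj) ^ p ∂P))
          + C * (1 / ((k : ℝ) + 1)) ^ (1 + m) := by
  have hΩ : Nonempty Ω := nonempty_of_isProbabilityMeasure P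
  have hR : 0 ≤ R := h.bound_nonneg (Classical.arbitrary Ω)
  have hp0 : 0 < p := by omega
  set Γ : ℝ := β * gaussianPDFReal 0 v 0 with hΓ
  have hΓ0 : 0 ≤ Γ := mul_nonneg hβ.le (gaussianPDFReal_nonneg _ _ _)
  have hγ0 : 0 < β * gaussianPDFReal 0 v D := mul_pos hβ (gaussianPDFReal_pos _ _ _ hv)
  set a : ℝ := t * wj with ha
  have ha0 : 0 < a := mul_pos (by linarith) hwj
  obtain ⟨C0, hC0, hlin⟩ := exists_add_pow_le_linear p hp hp2 (B := β / a) (by positivity)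
  set Ce : ℝ := (8 + Γ * ((n + 1) * (2 * R))) / a with hCe
  have hCe0 : 0 ≤ Ce := by positivity
  refine ⟨2 * (3 * (p ^ (p - 1) * Ce ^ p)) + C0, by positivity, fun k hk hΓτ => ?_⟩
  set τ : ℝ := 1 / ((k : ℝ) + 1) with hτ
  have hτ0 : 0 < τ := by positivity
  have hτ1 : τ ≤ 1 := by rw [hτ, div_le_one (by positivity)]; linarith [(k.cast_nonneg : (0:ℝ) ≤ k)]
  have hτm : 0 ≤ τ ^ (1 + m) := by positivity
  have hexpτ : Real.exp τ ≤ 3 :=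
    (Real.exp_le_exp.2 hτ1).trans (by linarith [Real.exp_one_lt_d9])
  set f : ℝ := 1 / (k : ℝ) ^ (1 + ε) with hf
  have hf0 : 0 ≤ f := by positivity
  have hf4 : f ≤ 4 * τ ^ (1 + ε) := one_div_rpow_le hε0 hε1 (by omega)
  let F : ℝ → ℝ := fun y => cdf (gaussianReal 0 v) y
  have hFm : Measurable F := (monotone_cdf _).measurable
  have hF1 : ∀ y, |F y| ≤ 1 := fun y =>
    abs_le.2 ⟨by linarith [cdf_nonneg (gaussianReal 0 v) y], cdf_le_one _ y⟩
  let A : Ω → ℝ := fun ω => xhat k i j ω - x (k + 1) (Fin.last n) ω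
    + β * τ * (F (thr i j - xhat k i j ω) - F (thr i j - x (k + 1) j ω))
  let N : Ω → ℝ := fun ω => F (thr i j - x (k + 1) j ω)
    - binaryObs (thr i j) (x (k + 1) j ω + ξ (k + 1) i j ω)
  let z : Ω → ℝ := fun ω => xhat k i j ω - x k (Fin.last n) ω
  let δ : Ω → ℝ := fun ω => x k j ω - x k (Fin.last n) ω
  have hxhatb : ∀ ω, |xhat k i j ω| ≤ R := h.abs_estimate_le k hij
  have hxb : ∀ i ω, |x k i ω| ≤ R := fun i ω => h.abs_state_le hpos hk i ω
  have hxb' : ∀ i ω, |x (k + 1) i ω| ≤ R := fun i ω => h.abs_state_le hpos (by omega) i ω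
  -- the conditional mean `A` is an averaging step, up to a small error
  have hA : ∀ ω, (A ω / a) ^ p ≤ Real.exp τ * (Real.exp (-(σ * (p - 1 : ℕ) * τ)) *
      ((z ω / a) ^ p + τ * (Γ * (δ ω / wj) ^ p)) + p ^ (p - 1) * Ce ^ p * τ ^ (1 + m)) := by
    intro ω
    have htb : ∀ y, |y| ≤ R → |thr i j - y| ≤ D := fun y hy =>
      (abs_sub _ _).trans (by linarith)
    obtain ⟨c, hc1, hc2, hc⟩ := exists_cdf_gaussianReal_sub_eq hv
      (htb _ (hxb' j ω)) (htb _ (hxhatb ω))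
    set θ : ℝ := β * c * τ with hθ
    have hθ1 : β * gaussianPDFReal 0 v D * τ ≤ θ := by rw [hθ]; gcongr
    have hθ2 : θ ≤ Γ * τ := by rw [hθ, hΓ]; gcongr
    have hθ0 : 0 ≤ θ := le_trans (by positivity) hθ1
    set e : ℝ := A ω - ((1 - θ) * z ω + θ * δ ω) with he
    have hAe : A ω = (1 - θ) * z ω + θ * δ ω + e := by rw [he]; ring
    have he1 : e = -f + θ * ((x (k + 1) j ω - x (k + 1) (Fin.last n) ω)
        - (x k j ω - x k (Fin.last n) ω) + f) := by
      have hl : x (k + 1) (Fin.last n) ω = x k (Fin.last n) ω + f := h.leader k ω (by omega)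
      have hc' : F (thr i j - xhat k i j ω) - F (thr i j - x (k + 1) j ω)
          = c * (x (k + 1) j ω - xhat k i j ω) := by
        rw [show x (k + 1) j ω - xhat k i j ω
          = (thr i j - xhat k i j ω) - (thr i j - x (k + 1) j ω) by ring]
        exact hc
      simp only [he, A, hc', hl, z, δ, hθ]
      ring
    have hττ : τ * τ ≤ τ ^ (1 + ε) := by
      have : τ * τ = τ ^ (2 : ℝ) := by rw [Real.rpow_two]; ring
      rw [this]
      exact Real.rpow_le_rpow_of_exponent_ge hτ0 hτ1 (by linarith)
    have he2 : |e| ≤ (8 + Γ * ((n + 1) * (2 * R))) * τ ^ (1 + ε) := by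
      have h1 := h.abs_error_succ_sub_le hpos hk j ω
      rw [abs_of_nonneg hf0] at h1
      have h2 : |e| ≤ f + θ * (f + τ * ((n + 1) * (2 * R))) := by
        rw [he1]
        refine (abs_add_le _ _).trans ?_
        rw [abs_neg, abs_of_nonneg hf0, abs_mul, abs_of_nonneg hθ0]
        gcongr
      have h3 : θ * f ≤ f := mul_le_of_le_one_left hf0 (hθ2.trans hΓτ)
      have h4 : θ * (τ * ((n + 1) * (2 * R))) ≤ Γ * ((n + 1) * (2 * R)) * τ ^ (1 + ε) := by
        calc θ * (τ * ((n + 1) * (2 * R))) ≤ Γ * τ * (τ * ((n + 1) * (2 * R))) := by gcongr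
          _ = Γ * ((n + 1) * (2 * R)) * (τ * τ) := by ring
          _ ≤ _ := by gcongr
      linarith
    have he3 : |e / a| ≤ Ce * τ ^ (1 + ε) := by
      rw [abs_div, abs_of_pos ha0, hCe, div_mul_eq_mul_div]
      gcongr
    rw [hAe]
    refine (estimate_step hp hp0 hτ0 ht hwj hγ0 hθ1 hθ2 (hθ2.trans hΓτ) hσ _ _ _).trans ?_
    have := perturbation_pow_le hp hp0 hτ0 hτ1 hCe0 he3 hm2
    gcongr Real.exp τ * (_ + ?_)
  -- one step of the estimate, before averaging over the noise
  have hstep : ∀ ω, ((xhat (k + 1) i j ω - x (k + 1) (Fin.last n) ω) / a) ^ p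
      ≤ (1 + τ) * (A ω / a) ^ p + (p * β * τ / a) * ((A ω / a) ^ (p - 1) * N ω)
        + C0 * τ ^ (1 + m) := by
    intro ω
    have hest := h.estimate (k + 1) i j ω (by omega) hij
    rw [Nat.add_sub_cancel] at hest
    have hτc : β / ((k + 1 : ℕ) : ℝ) = β * τ := by rw [hτ]; push_cast; ring
    rw [hτc] at hest
    have h1 : |(xhat (k + 1) i j ω - x (k + 1) (Fin.last n) ω) / a|
        ≤ |A ω / a + β * τ * N ω / a| := by
      rw [← add_div, abs_div, abs_div]
      refine div_le_div_of_nonneg_right ?_ (abs_nonneg a)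
      rw [hest]
      refine (abs_proj_sub_le (h.leader_bound (k + 1) ω) _).trans_eq ?_
      congr 1
      simp only [A, N, F]
      ring
    have hN : |N ω| ≤ 1 := by
      have h2 := binaryObs_mem (thr i j) (x (k + 1) j ω + ξ (k + 1) i j ω)
      have h3 := cdf_nonneg (gaussianReal 0 v) (thr i j - x (k + 1) j ω)
      have h4 := cdf_le_one (gaussianReal 0 v) (thr i j - x (k + 1) j ω)
      simp only [N, F]
      rw [abs_le]; constructor <;> linarith
    have h2 : |β * τ * N ω / a| ≤ β / a * τ := by
      rw [abs_div, abs_mul, abs_of_pos ha0, abs_of_nonneg (by positivity : 0 ≤ β * τ)]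
      calc β * τ * |N ω| / a ≤ β * τ * 1 / a := by gcongr
        _ = _ := by ring
    have h3 := hlin τ (A ω / a) (β * τ * N ω / a) hτ0 hτ1 h2
    have h4 : C0 * (τ * Real.sqrt τ ^ p) ≤ C0 * τ ^ (1 + m) := by
      gcongr; exact mul_sqrt_pow_le hτ0 hτ1 hm1
    calc _ = |(xhat (k + 1) i j ω - x (k + 1) (Fin.last n) ω) / a| ^ p := (hp.pow_abs _).symm
      _ ≤ |A ω / a + β * τ * N ω / a| ^ p := by gcongr
      _ = (A ω / a + β * τ * N ω / a) ^ p := hp.pow_abs _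
      _ ≤ _ := h3
      _ ≤ _ := by
        have : (p : ℝ) * (A ω / a) ^ (p - 1) * (β * τ * N ω / a)
          = (p * β * τ / a) * ((A ω / a) ^ (p - 1) * N ω) := by ring
        rw [this]; linarith
  -- measurability and boundedness
  have hxm := h.measurable_state
  have hxhatm := fun k => h.measurable_estimate k i j hij
  have hle := history_le (G := G) h.measurable_state h.measurable_estimate (k + 1)
  have hAh : Measurable[history G x xhat (k + 1)] fun ω => (A ω / a) ^ (p - 1) := by
    have h1 : Measurable[history G x xhat (k + 1)] (xhat k i j) :=
      measurable_history_estimate (Nat.lt_succ_self k) hij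
    have h2 : Measurable[history G x xhat (k + 1)] (x (k + 1) (Fin.last n)) :=
      measurable_history_state le_rfl _
    have h3 : Measurable[history G x xhat (k + 1)] (x (k + 1) j) :=
      measurable_history_state le_rfl _
    exact (((h1.sub h2).add (((hFm.comp (h1.const_sub _)).sub
      (hFm.comp (h3.const_sub _))).const_mul _)).div_const _).pow_const _
  have hYh : Measurable[history G x xhat (k + 1)] (x (k + 1) j) :=
    measurable_history_state le_rfl _
  have hAm : Measurable fun ω => A ω / a :=
    ((((hxhatm k).sub (hxm _ _)).add (((hFm.comp ((hxhatm k).const_sub _)).sub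
      (hFm.comp ((hxm _ _).const_sub _))).const_mul _)).div_const _)
  set M : ℝ := (2 * R + β * τ * 2) / a with hM
  have hAb : ∀ ω, |A ω / a| ≤ M := by
    intro ω
    rw [abs_div, abs_of_pos ha0, hM]
    gcongr
    refine (abs_add_le _ _).trans (add_le_add ?_ ?_)
    · exact (abs_sub _ _).trans (by linarith [hxhatb ω, hxb' (Fin.last n) ω])
    · rw [abs_mul, abs_of_nonneg (by positivity : 0 ≤ β * τ)]
      gcongr
      refine (abs_sub _ _).trans ?_
      linarith [hF1 (thr i j - xhat k i j ω), hF1 (thr i j - x (k + 1) j ω)]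
  have hmean : ∫ ω, (A ω / a) ^ (p - 1) * N ω ∂P = 0 :=
    integral_mul_cdf_sub_binaryObs_eq_zero hle hAh hYh
      (hnoise.measurable (k + 1) i j (by omega) hij) (hnoise.law (k + 1) i j (by omega) hij)
      (hnoise.indep (k + 1) i j (by omega) hij) (M := M ^ (p - 1))
      (fun ω => by rw [abs_pow]; exact pow_le_pow_left₀ (abs_nonneg _) (hAb ω) _) _
  have hAint : Integrable (fun ω => (A ω / a) ^ p) P :=
    integrable_pow_of_bounded hAm ⟨M, hAb⟩ p
  have hξm := hnoise.measurable (k + 1) i j (by omega) hij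
  have hANint : Integrable (fun ω => (A ω / a) ^ (p - 1) * N ω) P := by
    have hNm : Measurable N := (hFm.comp ((hxm _ _).const_sub _)).sub
      ((measurable_binaryObs _).comp ((hxm _ _).add hξm))
    refine Integrable.of_bound (C := M ^ (p - 1) * 2)
      ((hAm.pow_const _).mul hNm).aestronglyMeasurable (ae_of_all _ fun ω => ?_)
    rw [Real.norm_eq_abs, abs_mul, abs_pow]
    have h2 := binaryObs_mem (thr i j) (x (k + 1) j ω + ξ (k + 1) i j ω)
    have h3 := hF1 (thr i j - x (k + 1) j ω)
    gcongr
    · exact hAb ω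
    · refine (abs_sub _ _).trans ?_
      rw [abs_of_nonneg h2.1]; linarith
  have hzint : Integrable (fun ω => (z ω / a) ^ p) P :=
    integrable_pow_of_bounded (((hxhatm k).sub (hxm _ _)).div_const a) ⟨2 * R / a, fun ω => by
      rw [abs_div, abs_of_pos ha0]
      gcongr
      exact (abs_sub _ _).trans (by linarith [hxhatb ω, hxb (Fin.last n) ω])⟩ p
  have hδint : Integrable (fun ω => (δ ω / wj) ^ p) P :=
    integrable_pow_of_bounded (((hxm _ _).sub (hxm _ _)).div_const wj) ⟨2 * R / wj, fun ω => by
      rw [abs_div, abs_of_pos hwj]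
      gcongr
      exact (abs_sub _ _).trans (by linarith [hxb j ω, hxb (Fin.last n) ω])⟩ p
  have hz'int : Integrable (fun ω =>
      ((xhat (k + 1) i j ω - x (k + 1) (Fin.last n) ω) / a) ^ p) P :=
    integrable_pow_of_bounded (((hxhatm _).sub (hxm _ _)).div_const a) ⟨2 * R / a, fun ω => by
      rw [abs_div, abs_of_pos ha0]
      gcongr
      exact (abs_sub _ _).trans
        (by linarith [h.abs_estimate_le (k + 1) hij ω, hxb' (Fin.last n) ω])⟩ p
  have hI1 : ∫ ω, ((xhat (k + 1) i j ω - x (k + 1) (Fin.last n) ω) / a) ^ p ∂P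
      ≤ (1 + τ) * ∫ ω, (A ω / a) ^ p ∂P + C0 * τ ^ (1 + m) := by
    have := integral_le_of_le_add hz'int hAint hANint hstep
    rwa [hmean, mul_zero, add_zero] at this
  set E : ℝ := Real.exp (-(σ * (p - 1 : ℕ) * τ)) with hE
  have hI2 : ∫ ω, (A ω / a) ^ p ∂P ≤ Real.exp τ * (E * (∫ ω, (z ω / a) ^ p ∂P
      + τ * (Γ * ∫ ω, (δ ω / wj) ^ p ∂P)) + p ^ (p - 1) * Ce ^ p * τ ^ (1 + m)) := by
    refine (integral_le_of_le_add hAint hzint hδint (c₁ := Real.exp τ * E)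
      (c₂ := Real.exp τ * E * (τ * Γ))
      (b := Real.exp τ * (p ^ (p - 1) * Ce ^ p * τ ^ (1 + m)))
      fun ω => (hA ω).trans_eq (by ring)).trans_eq (by ring)
  have hZ0 : 0 ≤ ∫ ω, (z ω / a) ^ p ∂P + τ * (Γ * ∫ ω, (δ ω / wj) ^ p ∂P) := by
    have h1 : 0 ≤ ∫ ω, (z ω / a) ^ p ∂P := integral_nonneg fun ω => hp.pow_nonneg _
    have h2 : 0 ≤ ∫ ω, (δ ω / wj) ^ p ∂P := integral_nonneg fun ω => hp.pow_nonneg _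
    positivity
  set Z : ℝ := ∫ ω, (z ω / a) ^ p ∂P + τ * (Γ * ∫ ω, (δ ω / wj) ^ p ∂P) with hZ
  have hexp2 : Real.exp (2 * τ - σ * (p - 1 : ℕ) * τ) = Real.exp τ * Real.exp τ * E := by
    rw [hE, ← Real.exp_add, ← Real.exp_add]; congr 1; ring
  rw [hexp2]
  have hE0 : 0 < E := Real.exp_pos _
  set L : ℝ := p ^ (p - 1) * Ce ^ p with hL
  have hL0 : 0 ≤ L := by positivity
  calc _ ≤ (1 + τ) * ∫ ω, (A ω / a) ^ p ∂P + C0 * τ ^ (1 + m) := hI1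
    _ ≤ (1 + τ) * (Real.exp τ * (E * Z + L * τ ^ (1 + m))) + C0 * τ ^ (1 + m) := by
        gcongr
    _ = (1 + τ) * (Real.exp τ * (E * Z)) + ((1 + τ) * (Real.exp τ * L) + C0) * τ ^ (1 + m) := by
        ring
    _ ≤ Real.exp τ * (Real.exp τ * (E * Z)) + (2 * (3 * L) + C0) * τ ^ (1 + m) := by
        have h1 : 1 + τ ≤ Real.exp τ := by linarith [Real.add_one_le_exp τ]
        have h2 : 1 + τ ≤ 2 := by linarith
        gcongr
    _ = _ := by ring

end MomentRecursion

/-! ### Decay of all moments and of the mean squares -/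

section MeanSquareRate

variable {n : ℕ} {Ω : Type*} [MeasurableSpace Ω] {P : Measure Ω} [IsProbabilityMeasure P]
  {G : Digraph (Fin (n + 1))} [DecidableRel G.Adj] {R β ε : ℝ} {v : ℝ≥0}
  {thr : Fin n → Fin (n + 1) → ℝ}
  {x : ℕ → Fin (n + 1) → Ω → ℝ} {xhat ξ : ℕ → Fin n → Fin (n + 1) → Ω → ℝ}

theorem IsCRS.measurable_error {f : ℕ → ℝ} {F : ℝ → ℝ} (h : IsCRS G f R β F thr x xhat ξ) (k : ℕ)
    (i : Fin (n + 1)) : Measurable fun ω => x k i ω - x k (Fin.last n) ω :=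
  (h.measurable_state k i).sub (h.measurable_state k _)

theorem IsCRS.measurable_estimateError {f : ℕ → ℝ} {F : ℝ → ℝ}
    (h : IsCRS G f R β F thr x xhat ξ) (k : ℕ) {i : Fin n} {j : Fin (n + 1)}
    (hij : G.Adj j i.castSucc) (l : Fin (n + 1)) : Measurable fun ω => xhat k i j ω - x k l ω :=
  (h.measurable_estimate k i j hij).sub (h.measurable_state k l)

theorem IsCRS.exists_abs_error_le {f : ℕ → ℝ} {F : ℝ → ℝ} (h : IsCRS G f R β F thr x xhat ξ)
    (k : ℕ) (i : Fin (n + 1)) : ∃ C, ∀ ω, |x k i ω - x k (Fin.last n) ω| ≤ C := by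
  obtain ⟨C, hC⟩ := h.exists_abs_state_le k i
  exact ⟨C + R, fun ω => (abs_sub _ _).trans (add_le_add (hC ω) (h.leader_bound k ω))⟩

theorem IsCRS.exists_abs_estimateError_le {f : ℕ → ℝ} {F : ℝ → ℝ}
    (h : IsCRS G f R β F thr x xhat ξ) (k : ℕ) {i : Fin n} {j : Fin (n + 1)}
    (hij : G.Adj j i.castSucc) (l : Fin (n + 1)) : ∃ C, ∀ ω, |xhat k i j ω - x k l ω| ≤ C := by
  obtain ⟨C, hC⟩ := h.exists_abs_state_le k l
  exact ⟨R + C, fun ω => (abs_sub _ _).trans (add_le_add (h.abs_estimate_le k hij ω) (hC ω))⟩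

theorem integrable_div_pow {g : Ω → ℝ} (hg : Measurable g) (hb : ∃ C, ∀ ω, |g ω| ≤ C) (a : ℝ)
    (p : ℕ) : Integrable (fun ω => (g ω / a) ^ p) P := by
  simp_rw [div_pow]
  exact (integrable_pow_of_bounded hg hb p).div_const _

theorem memLp_two_of_bounded {g : Ω → ℝ} (hg : Measurable g) (hb : ∃ C, ∀ ω, |g ω| ≤ C) :
    MemLp g 2 P := by
  obtain ⟨C, hC⟩ := hb
  exact MemLp.of_bound hg.aestronglyMeasurable C (ae_of_all _ hC)

theorem IsCRS.follower_moment_step {F : ℝ → ℝ}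
    (h : IsCRS G (fun k => 1 / (k : ℝ) ^ (1 + ε)) R β F thr x xhat ξ) (hε0 : 0 < ε) (hε1 : ε < 1)
    {t σ m c : ℝ} {w : Fin (n + 1) → ℝ} (ht : 1 < t) (hw : ∀ j, 0 < w j) {i : Fin n}
    (hc : ∀ j, t * w j / w i.castSucc ≤ c)
    (hσ : t * ∑ j, adjacency G i.castSucc j * w j
      ≤ (neighborCount G i.castSucc - σ) * w i.castSucc) {p : ℕ}
    (hp : Even p) (hp2 : 2 ≤ p) (hm2 : m ≤ p * ε) :
    ∃ C, 0 ≤ C ∧ ∀ k : ℕ, n + 1 ≤ k →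
      ∫ ω, ((x (k + 1) i.castSucc ω - x (k + 1) (Fin.last n) ω) / w i.castSucc) ^ p ∂P
        ≤ Real.exp (2 * (1 / ((k : ℝ) + 1)) - σ * (p - 1 : ℕ) * (1 / ((k : ℝ) + 1))) *
          (∫ ω, ((x k i.castSucc ω - x k (Fin.last n) ω) / w i.castSucc) ^ p ∂P
            + (1 / ((k : ℝ) + 1)) * (c * ∑ j ∈ neighbors G i,
              ∫ ω, ((xhat k i j ω - x k (Fin.last n) ω) / (t * w j)) ^ p ∂P))
          + C * (1 / ((k : ℝ) + 1)) ^ (1 + m) := by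
  have hp0 : 0 < p := by omega
  have hwi := hw i.castSucc
  have hc0 : 0 ≤ c := le_trans (by have := hw 0; positivity) (hc 0)
  rw [sum_adjacency_mul, ← card_neighbors] at hσ
  refine ⟨3 * (p ^ (p - 1) * (4 / w i.castSucc) ^ p), by positivity, fun k hk => ?_⟩
  set τ : ℝ := 1 / ((k : ℝ) + 1) with hτ
  have hτ0 : 0 < τ := by positivity
  have hτ1 : τ ≤ 1 := by rw [hτ, div_le_one (by positivity)]; linarith [(k.cast_nonneg : (0:ℝ) ≤ k)]
  have hexpτ : Real.exp τ ≤ 3 :=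
    (Real.exp_le_exp.2 hτ1).trans (by linarith [Real.exp_one_lt_d9])
  have hcard : ((neighbors G i).card : ℝ) * τ ≤ 1 := by
    have h1 : ((neighbors G i).card : ℝ) ≤ (k : ℝ) + 1 := by
      exact_mod_cast (neighborCount_le i.castSucc).trans (hk.trans (Nat.le_succ k))
    rw [hτ, mul_one_div, div_le_one (by positivity)]; exact h1
  set f : ℝ := 1 / (k : ℝ) ^ (1 + ε) with hf
  have hf0 : 0 ≤ f := by positivity
  have hfw : |f / w i.castSucc| ≤ 4 / w i.castSucc * τ ^ (1 + ε) := by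
    rw [abs_div, abs_of_nonneg hf0, abs_of_pos hwi, div_mul_eq_mul_div]
    gcongr
    exact one_div_rpow_le hε0 hε1 (by omega)
  have hfp := perturbation_pow_le hp hp0 hτ0 hτ1 (by positivity) hfw hm2
  set E : ℝ := Real.exp (-(σ * (p - 1 : ℕ) * τ)) with hE
  set L : ℝ := p ^ (p - 1) * (4 / w i.castSucc) ^ p with hL
  have hL0 : 0 ≤ L := by positivity
  have hpt : ∀ ω, ((x (k + 1) i.castSucc ω - x (k + 1) (Fin.last n) ω) / w i.castSucc) ^ p
      ≤ (Real.exp τ * E) * ((x k i.castSucc ω - x k (Fin.last n) ω) / w i.castSucc) ^ p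
        + (Real.exp τ * E * (τ * c)) * ∑ j ∈ neighbors G i,
            ((xhat k i j ω - x k (Fin.last n) ω) / (t * w j)) ^ p
        + Real.exp τ * (L * τ ^ (1 + m)) := by
    intro ω
    have hstep := follower_step (neighbors G i) hp hp0 hτ0 (by linarith) hwi hw hc hcard hσ
      (x k i.castSucc ω - x k (Fin.last n) ω) f fun j => xhat k i j ω - x k (Fin.last n) ω
    have hl : x (k + 1) (Fin.last n) ω = x k (Fin.last n) ω + f := h.leader k ω (by omega)
    have hx : x k i.castSucc ω - x k (Fin.last n) ω - τ * ∑ j ∈ neighbors G i,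
        (x k i.castSucc ω - x k (Fin.last n) ω - (xhat k i j ω - x k (Fin.last n) ω)) - f
        = x (k + 1) i.castSucc ω - x (k + 1) (Fin.last n) ω := by
      rw [h.control_eq, hl]
      simp only [sub_sub_sub_cancel_right]
      ring
    rw [hx] at hstep
    refine hstep.trans ?_
    have := mul_le_mul_of_nonneg_left hfp (Real.exp_pos τ).le
    rw [mul_add, ← hE]
    refine (add_le_add_right this _).trans_eq ?_
    ring
  have hzint : ∀ j ∈ neighbors G i, Integrable (fun ω =>
      ((xhat k i j ω - x k (Fin.last n) ω) / (t * w j)) ^ p) P := fun j hj =>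
    integrable_div_pow (h.measurable_estimateError k (mem_neighbors.1 hj) _)
      (h.exists_abs_estimateError_le k (mem_neighbors.1 hj) _) _ _
  have hI := integral_le_of_le_add (P := P)
    (integrable_div_pow (h.measurable_error (k + 1) _) (h.exists_abs_error_le (k + 1) _) _ _)
    (integrable_div_pow (h.measurable_error k _) (h.exists_abs_error_le k _) _ _)
    (integrable_finsetSum _ hzint) hpt
  rw [integral_finsetSum _ hzint] at hI
  refine hI.trans ?_
  have hu0 : 0 ≤ ∫ ω, ((x k i.castSucc ω - x k (Fin.last n) ω) / w i.castSucc) ^ p ∂P :=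
    integral_nonneg fun ω => hp.pow_nonneg _
  have hv0 : 0 ≤ ∑ j ∈ neighbors G i,
      ∫ ω, ((xhat k i j ω - x k (Fin.last n) ω) / (t * w j)) ^ p ∂P :=
    Finset.sum_nonneg fun j _ => integral_nonneg fun ω => hp.pow_nonneg _
  set U := ∫ ω, ((x k i.castSucc ω - x k (Fin.last n) ω) / w i.castSucc) ^ p ∂P
  set S := ∑ j ∈ neighbors G i,
    ∫ ω, ((xhat k i j ω - x k (Fin.last n) ω) / (t * w j)) ^ p ∂P
  have hexp2 : Real.exp (2 * τ - σ * (p - 1 : ℕ) * τ) = Real.exp τ * (Real.exp τ * E) := by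
    rw [hE, ← Real.exp_add, ← Real.exp_add]; congr 1; ring
  have h1 : 1 ≤ Real.exp τ := Real.one_le_exp hτ0.le
  have hE0 : 0 < E := Real.exp_pos _
  have hq : 0 ≤ Real.exp τ * E * (U + τ * (c * S)) := by positivity
  have hτm : 0 ≤ τ ^ (1 + m) := by positivity
  calc _ = 1 * (Real.exp τ * E * (U + τ * (c * S))) + Real.exp τ * (L * τ ^ (1 + m)) := by ring
    _ ≤ Real.exp τ * (Real.exp τ * E * (U + τ * (c * S))) + 3 * (L * τ ^ (1 + m)) := by gcongr
    _ = _ := by rw [hexp2]; ring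

theorem weighted_sum_step (N : Fin n → Finset (Fin (n + 1))) {a a' : Fin (n + 1) → ℝ}
    {b b' : Fin n → Fin (n + 1) → ℝ} (ha : ∀ i, 0 ≤ a i) (hb : ∀ i j, 0 ≤ b i j)
    (hlast : a (Fin.last n) = 0) {E τ c Γ T : ℝ} (hE : 0 ≤ E) (hτ : 0 ≤ τ) (hc : 0 ≤ c)
    (hΓ : 0 ≤ Γ) {C : Fin n → ℝ} {C' : Fin n → Fin (n + 1) → ℝ}
    (h₁ : ∀ i : Fin n, a' i.castSucc ≤ E * (a i.castSucc + τ * (c * ∑ j ∈ N i, b i j)) + C i * T)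
    (h₂ : ∀ i, ∀ j ∈ N i, b' i j ≤ E * (b i j + τ * (Γ * a j)) + C' i j * T) :
    ∑ i : Fin n, (a' i.castSucc + ∑ j ∈ N i, b' i j)
      ≤ E * (1 + τ * (c + n * Γ)) * ∑ i : Fin n, (a i.castSucc + ∑ j ∈ N i, b i j)
        + (∑ i, (C i + ∑ j ∈ N i, C' i j)) * T := by
  set A := ∑ i : Fin n, a i.castSucc with hA
  set B := ∑ i, ∑ j ∈ N i, b i j with hB
  have hA0 : 0 ≤ A := Finset.sum_nonneg fun i _ => ha _
  have hB0 : 0 ≤ B := Finset.sum_nonneg fun i _ => Finset.sum_nonneg fun j _ => hb i j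
  have hNA : ∑ i, ∑ j ∈ N i, a j ≤ n * A := by
    refine (Finset.sum_le_card_nsmul _ _ A fun i _ => ?_).trans_eq (by simp)
    refine (Finset.sum_le_univ_sum_of_nonneg ha).trans_eq ?_
    rw [Fin.sum_univ_castSucc, hlast, add_zero]
  have hsum : ∑ i : Fin n, (a i.castSucc + ∑ j ∈ N i, b i j) = A + B := Finset.sum_add_distrib
  rw [hsum]
  have h3 : ∑ i : Fin n, (a' i.castSucc + ∑ j ∈ N i, b' i j)
      ≤ ∑ i : Fin n, (E * (a i.castSucc + τ * (c * ∑ j ∈ N i, b i j)) + C i * T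
        + ∑ j ∈ N i, (E * (b i j + τ * (Γ * a j)) + C' i j * T)) :=
    Finset.sum_le_sum fun i _ => add_le_add (h₁ i) (Finset.sum_le_sum (h₂ i))
  have h4 : ∑ i : Fin n, (E * (a i.castSucc + τ * (c * ∑ j ∈ N i, b i j)) + C i * T
        + ∑ j ∈ N i, (E * (b i j + τ * (Γ * a j)) + C' i j * T))
      = E * (A + τ * (c * B)) + E * (B + τ * (Γ * ∑ i, ∑ j ∈ N i, a j))
        + (∑ i, (C i + ∑ j ∈ N i, C' i j)) * T := by
    simp only [Finset.sum_add_distrib, ← Finset.mul_sum, ← Finset.sum_mul, hA, hB]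
    ring
  rw [h4] at h3
  refine h3.trans ?_
  have h5 : E * (A + τ * (c * B)) + E * (B + τ * (Γ * ∑ i, ∑ j ∈ N i, a j))
      ≤ E * (A + τ * (c * B)) + E * (B + τ * (Γ * (n * A))) := by gcongr
  have h6 : 0 ≤ E * (τ * (c * A + n * Γ * B)) := by positivity
  linarith

/-- The weighted sum of the `p`-th moments of all deviations from the leader. -/
noncomputable def momentSum (P : Measure Ω) (G : Digraph (Fin (n + 1))) [DecidableRel G.Adj]
    (x : ℕ → Fin (n + 1) → Ω → ℝ) (xhat : ℕ → Fin n → Fin (n + 1) → Ω → ℝ)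
    (w : Fin (n + 1) → ℝ) (t : ℝ) (p k : ℕ) : ℝ :=
  ∑ i : Fin n, (∫ ω, ((x k i.castSucc ω - x k (Fin.last n) ω) / w i.castSucc) ^ p ∂P
    + ∑ j ∈ neighbors G i, ∫ ω, ((xhat k i j ω - x k (Fin.last n) ω) / (t * w j)) ^ p ∂P)

/-- The loss `C₁` does not depend on the order `p` of the moment, whereas the contraction rate grows
like `σ p`. -/
theorem IsCRS.exists_momentSum_recursion
    (h : IsCRS G (fun k => 1 / (k : ℝ) ^ (1 + ε)) R β (fun y => cdf (gaussianReal 0 v) y)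
      thr x xhat ξ) (hnoise : IsLinkNoise G P v x xhat ξ) (hv : v ≠ 0) (hε0 : 0 < ε) (hε1 : ε < 1)
    (hβ : 0 < β) (hpos : ∀ i : Fin n, 0 < neighborCount G i.castSucc) {D t σ : ℝ}
    (hthr : ∀ i j, G.Adj j i.castSucc → |thr i j| + R ≤ D)
    {w : Fin (n + 1) → ℝ} (ht : 1 < t) (hw : ∀ j, 0 < w j)
    (hσ : σ * t ≤ β * gaussianPDFReal 0 v D * (t - 1))
    (hσw : ∀ i : Fin n, t * ∑ j, adjacency G i.castSucc j * w j
      ≤ (neighborCount G i.castSucc - σ) * w i.castSucc) :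
    ∃ C₁ : ℝ, ∀ (p : ℕ) (m : ℝ), Even p → 2 ≤ p → m ≤ p / 2 → m ≤ p * ε →
      ∃ (C : ℝ) (K : ℕ), 0 ≤ C ∧ ∀ k, K ≤ k → momentSum P G x xhat w t p (k + 1)
        ≤ Real.exp (-(σ * (p - 1 : ℕ) - 2 - C₁) * (1 / ((k : ℝ) + 1)))
            * momentSum P G x xhat w t p k
          + C * (1 / ((k : ℝ) + 1)) ^ (1 + m) := by
  set Γ : ℝ := β * gaussianPDFReal 0 v 0 with hΓ
  have hΓ0 : 0 ≤ Γ := mul_nonneg hβ.le (gaussianPDFReal_nonneg _ _ _)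
  have hr0 : ∀ i j, 0 ≤ t * w j / w i := fun i j => by
    have := hw i; have := hw j; positivity
  set c : ℝ := ∑ i, ∑ j, t * w j / w i with hcdef
  have hc : ∀ i j, t * w j / w i ≤ c := fun i j =>
    (Finset.single_le_sum (f := fun j => t * w j / w i) (fun j _ => hr0 i j)
      (Finset.mem_univ j)).trans
    (Finset.single_le_sum (f := fun i => ∑ j, t * w j / w i)
      (fun i _ => Finset.sum_nonneg fun j _ => hr0 i j) (Finset.mem_univ i))
  have hc0 : 0 ≤ c := (hr0 0 0).trans (hc 0 0)
  refine ⟨c + n * Γ, fun p m hp hp2 hm1 hm2 => ?_⟩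
  have hp0 : 0 < p := by omega
  choose Cf hCf0 hCf using fun i : Fin n => h.follower_moment_step (P := P) hε0 hε1 ht hw
    (hc i.castSucc) (hσw i) hp hp2 hm2
  have hest : ∀ (i : Fin n) (j : Fin (n + 1)), ∃ C, 0 ≤ C ∧ (G.Adj j i.castSucc →
      ∀ k : ℕ, n + 1 ≤ k → Γ * (1 / ((k : ℝ) + 1)) ≤ 1 →
      ∫ ω, ((xhat (k + 1) i j ω - x (k + 1) (Fin.last n) ω) / (t * w j)) ^ p ∂P
        ≤ Real.exp (2 * (1 / ((k : ℝ) + 1)) - σ * (p - 1 : ℕ) * (1 / ((k : ℝ) + 1))) *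
          (∫ ω, ((xhat k i j ω - x k (Fin.last n) ω) / (t * w j)) ^ p ∂P
            + (1 / ((k : ℝ) + 1)) * (Γ *
              ∫ ω, ((x k j ω - x k (Fin.last n) ω) / w j) ^ p ∂P))
          + C * (1 / ((k : ℝ) + 1)) ^ (1 + m)) := by
    intro i j
    by_cases hij : G.Adj j i.castSucc
    · obtain ⟨C, hC0, hC⟩ := h.estimate_moment_step hnoise hv hε0 hε1 hβ hpos ht (hw j) hσ hp hp2
        hm1 hm2 hij (hthr i j hij)
      exact ⟨C, hC0, fun _ => hC⟩
    · exact ⟨0, le_rfl, fun hij' => absurd hij' hij⟩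
  choose Ce hCe0 hCe using hest
  obtain ⟨K, hK⟩ := exists_nat_ge Γ
  refine ⟨∑ i, (Cf i + ∑ j ∈ neighbors G i, Ce i j), max (n + 1) K,
    Finset.sum_nonneg fun i _ => add_nonneg (hCf0 i) (Finset.sum_nonneg fun j _ => hCe0 i j),
    fun k hk => ?_⟩
  set τ : ℝ := 1 / ((k : ℝ) + 1) with hτ
  have hτ0 : 0 < τ := by positivity
  have hkn : n + 1 ≤ k := (le_max_left _ _).trans hk
  have hΓτ : Γ * τ ≤ 1 := by
    have h1 : (K : ℝ) ≤ k := by exact_mod_cast (le_max_right _ _).trans hk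
    rw [hτ, mul_one_div, div_le_one (by positivity)]; linarith
  have hrec := weighted_sum_step (neighbors G)
    (a := fun i => ∫ ω, ((x k i ω - x k (Fin.last n) ω) / w i) ^ p ∂P)
    (a' := fun i => ∫ ω, ((x (k + 1) i ω - x (k + 1) (Fin.last n) ω) / w i) ^ p ∂P)
    (b := fun i j => ∫ ω, ((xhat k i j ω - x k (Fin.last n) ω) / (t * w j)) ^ p ∂P)
    (b' := fun i j => ∫ ω, ((xhat (k + 1) i j ω - x (k + 1) (Fin.last n) ω) / (t * w j)) ^ p ∂P)
    (fun i => integral_nonneg fun ω => hp.pow_nonneg _)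
    (fun i j => integral_nonneg fun ω => hp.pow_nonneg _)
    (by simp [hp0.ne']) (Real.exp_pos _).le hτ0.le hc0 hΓ0 (fun i => hCf i k hkn)
    (fun i j hj => hCe i j (mem_neighbors.1 hj) k hkn hΓτ)
  refine hrec.trans (add_le_add_left ?_ _)
  have hΦ0 : 0 ≤ momentSum P G x xhat w t p k :=
    Finset.sum_nonneg fun i _ => add_nonneg (integral_nonneg fun ω => hp.pow_nonneg _)
      (Finset.sum_nonneg fun j _ => integral_nonneg fun ω => hp.pow_nonneg _)
  refine mul_le_mul_of_nonneg_right ?_ hΦ0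
  calc Real.exp (2 * τ - σ * (p - 1 : ℕ) * τ) * (1 + τ * (c + n * Γ))
      ≤ Real.exp (2 * τ - σ * (p - 1 : ℕ) * τ) * Real.exp (τ * (c + n * Γ)) := by
        gcongr; linarith [Real.add_one_le_exp (τ * (c + n * Γ))]
    _ = _ := by rw [← Real.exp_add]; congr 1; ring

/-- Some even moment decays at the rate that the exponent `s` for mean squares suggests. -/
theorem IsCRS.exists_moment_order
    (h : IsCRS G (fun k => 1 / (k : ℝ) ^ (1 + ε)) R β (fun y => cdf (gaussianReal 0 v) y)
      thr x xhat ξ) (hnoise : IsLinkNoise G P v x xhat ξ) (hv : v ≠ 0) (hε0 : 0 < ε) (hε1 : ε < 1)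
    (hβ : 0 < β) (hpos : ∀ i : Fin n, 0 < neighborCount G i.castSucc) {D t σ s : ℝ}
    (hthr : ∀ i j, G.Adj j i.castSucc → |thr i j| + R ≤ D)
    {w : Fin (n + 1) → ℝ} (ht : 1 < t) (hw : ∀ j, 0 < w j)
    (hσ : σ * t ≤ β * gaussianPDFReal 0 v D * (t - 1))
    (hσw : ∀ i : Fin n, t * ∑ j, adjacency G i.castSucc j * w j
      ≤ (neighborCount G i.castSucc - σ) * w i.castSucc)
    (hs0 : 0 < s) (hsε : s ≤ ε) (hsσ : s / 2 < σ) :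
    ∃ (r : ℕ) (C : ℝ) (K : ℕ), 0 < r ∧ ∀ k, K ≤ k →
      momentSum P G x xhat w t (2 * r) k ≤ C * (1 / (k : ℝ)) ^ (r * s) := by
  obtain ⟨C₁, hC₁⟩ := h.exists_momentSum_recursion hnoise hv hε0 hε1 hβ hpos hthr ht hw hσ hσw
  obtain ⟨r, hr⟩ := exists_nat_gt (max 1 ((σ + 2 + C₁) / (2 * σ - s)))
  have hr1 : (1 : ℝ) < r := (le_max_left _ _).trans_lt hr
  have hr0 : 0 < r := by exact_mod_cast zero_lt_one.trans hr1
  have hr2 : σ + 2 + C₁ < r * (2 * σ - s) := by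
    rw [← div_lt_iff₀ (by linarith)]; exact (le_max_right _ _).trans_lt hr
  have hrs : (r : ℝ) * s ≤ r * ε := by gcongr
  have hrε : (r : ℝ) * ε ≤ r * 1 := by gcongr
  obtain ⟨C, K, hC0, hC⟩ := hC₁ (2 * r) (r * s) (even_two_mul r) (by omega)
    (by push_cast; linarith) (by push_cast; nlinarith)
  obtain ⟨D', K', -, hD'⟩ := exists_rpow_bound_of_recursion (Φ := momentSum P G x xhat w t (2 * r))
    (m := r * s) (by positivity) (by
      rw [Nat.cast_sub (by omega)]; push_cast; linarith) hC0 hC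
  exact ⟨r, D', K', hr0, hD'⟩

/-- All mean squares of the deviations from the leader decay like `k ^ (-s)`, for every
`s ≤ ε` below twice the decay rate `σ` that the weights certify. -/
theorem IsCRS.exists_meanSquare_bound
    (h : IsCRS G (fun k => 1 / (k : ℝ) ^ (1 + ε)) R β (fun y => cdf (gaussianReal 0 v) y)
      thr x xhat ξ) (hnoise : IsLinkNoise G P v x xhat ξ) (hv : v ≠ 0) (hε0 : 0 < ε) (hε1 : ε < 1)
    (hβ : 0 < β) (hpos : ∀ i : Fin n, 0 < neighborCount G i.castSucc) {D t σ s : ℝ}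
    (hthr : ∀ i j, G.Adj j i.castSucc → |thr i j| + R ≤ D)
    {w : Fin (n + 1) → ℝ} (ht : 1 < t) (hw : ∀ j, 0 < w j)
    (hσ : σ * t ≤ β * gaussianPDFReal 0 v D * (t - 1))
    (hσw : ∀ i : Fin n, t * ∑ j, adjacency G i.castSucc j * w j
      ≤ (neighborCount G i.castSucc - σ) * w i.castSucc)
    (hs0 : 0 < s) (hsε : s ≤ ε) (hsσ : s / 2 < σ) :
    (∀ i : Fin (n + 1), ∃ (C : ℝ) (K : ℕ), ∀ k, K ≤ k →
      ∫ ω, (x k i ω - x k (Fin.last n) ω) ^ 2 ∂P ≤ C * (1 / (k : ℝ)) ^ s) ∧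
    ∀ (i : Fin n) (j : Fin (n + 1)), G.Adj j i.castSucc → ∃ (C : ℝ) (K : ℕ), ∀ k, K ≤ k →
      ∫ ω, (xhat k i j ω - x k (Fin.last n) ω) ^ 2 ∂P ≤ C * (1 / (k : ℝ)) ^ s := by
  obtain ⟨r, C, K, hr0, hC⟩ := h.exists_moment_order hnoise hv hε0 hε1 hβ hpos hthr ht hw hσ hσw
    hs0 hsε hsσ
  have hterm : ∀ k, (∀ i : Fin n, 0 ≤
      ∫ ω, ((x k i.castSucc ω - x k (Fin.last n) ω) / w i.castSucc) ^ (2 * r) ∂P) ∧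
      ∀ (i : Fin n) (j : Fin (n + 1)), 0 ≤
        ∫ ω, ((xhat k i j ω - x k (Fin.last n) ω) / (t * w j)) ^ (2 * r) ∂P := fun k =>
    ⟨fun i => integral_nonneg fun ω => (even_two_mul r).pow_nonneg _,
      fun i j => integral_nonneg fun ω => (even_two_mul r).pow_nonneg _⟩
  have hle : ∀ k (i : Fin n),
      ∫ ω, ((x k i.castSucc ω - x k (Fin.last n) ω) / w i.castSucc) ^ (2 * r) ∂P
        + ∑ j ∈ neighbors G i,
          ∫ ω, ((xhat k i j ω - x k (Fin.last n) ω) / (t * w j)) ^ (2 * r) ∂P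
      ≤ momentSum P G x xhat w t (2 * r) k := fun k i =>
    Finset.single_le_sum (f := fun i : Fin n =>
      ∫ ω, ((x k i.castSucc ω - x k (Fin.last n) ω) / w i.castSucc) ^ (2 * r) ∂P
        + ∑ j ∈ neighbors G i,
          ∫ ω, ((xhat k i j ω - x k (Fin.last n) ω) / (t * w j)) ^ (2 * r) ∂P)
      (fun i _ => add_nonneg ((hterm k).1 i) (Finset.sum_nonneg fun j _ => (hterm k).2 i j))
      (Finset.mem_univ i)
  -- undo the weights and pass from the moment of order `2 r` to the mean square
  have hmain : ∀ (g : ℕ → Ω → ℝ) (a : ℝ), 0 < a → (∀ k, Measurable (g k)) →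
      (∀ k, ∃ C, ∀ ω, |g k ω| ≤ C) →
      (∀ k, ∫ ω, (g k ω / a) ^ (2 * r) ∂P ≤ momentSum P G x xhat w t (2 * r) k) →
      ∃ (C : ℝ) (K : ℕ), ∀ k, K ≤ k → ∫ ω, g k ω ^ 2 ∂P ≤ C * (1 / (k : ℝ)) ^ s := by
    intro g a ha hgm hgb hg
    refine ⟨a ^ 2 * (1 + C), max K 1, fun k hk => ?_⟩
    have hk0 : (0 : ℝ) < k := by exact_mod_cast (le_max_right K 1).trans hk
    have h1 := integral_sq_le_of_moment (P := P) (g := fun ω => g k ω / a) hr0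
      (one_div_pos.2 hk0) (integrable_div_pow (hgm k) (hgb k) a 2)
      (integrable_div_pow (hgm k) (hgb k) a _)
      ((hg k).trans (hC k ((le_max_left _ _).trans hk)))
    have h2 : ∫ ω, g k ω ^ 2 ∂P = a ^ 2 * ∫ ω, (g k ω / a) ^ 2 ∂P := by
      rw [← integral_const_mul]
      congr 1; ext ω; field_simp
    rw [h2, mul_assoc]
    gcongr
  refine ⟨fun i => ?_, fun i j hij => ?_⟩
  · refine Fin.lastCases ?_ (fun i => ?_) i
    · exact ⟨0, 0, fun k _ => by simp⟩
    · exact hmain _ (w i.castSucc) (hw _) (fun k => h.measurable_error k _)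
        (fun k => h.exists_abs_error_le k _) fun k => (le_add_of_nonneg_right
          (Finset.sum_nonneg fun j _ => (hterm k).2 i j)).trans (hle k i)
  · exact hmain _ (t * w j) (mul_pos (by linarith) (hw j))
      (fun k => h.measurable_estimateError k hij _)
      (fun k => h.exists_abs_estimateError_le k hij _) fun k =>
        (Finset.single_le_sum (f := fun j =>
          ∫ ω, ((xhat k i j ω - x k (Fin.last n) ω) / (t * w j)) ^ (2 * r) ∂P)
          (fun j _ => (hterm k).2 i j) (mem_neighbors.2 hij)).trans
        ((le_add_of_nonneg_left ((hterm k).1 i)).trans (hle k i))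

theorem IsCRS.exists_meanSquare_link_bound {f : ℕ → ℝ} {F : ℝ → ℝ}
    (h : IsCRS G f R β F thr x xhat ξ) {s : ℝ} {i : Fin n} {j : Fin (n + 1)}
    (hij : G.Adj j i.castSucc)
    (h₁ : ∃ (C : ℝ) (K : ℕ), ∀ k, K ≤ k →
      ∫ ω, (x k j ω - x k (Fin.last n) ω) ^ 2 ∂P ≤ C * (1 / (k : ℝ)) ^ s)
    (h₂ : ∃ (C : ℝ) (K : ℕ), ∀ k, K ≤ k →
      ∫ ω, (xhat k i j ω - x k (Fin.last n) ω) ^ 2 ∂P ≤ C * (1 / (k : ℝ)) ^ s) :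
    ∃ (C : ℝ) (K : ℕ), ∀ k, K ≤ k →
      ∫ ω, (xhat k i j ω - x k j ω) ^ 2 ∂P ≤ C * (1 / (k : ℝ)) ^ s := by
  obtain ⟨C, K, hC⟩ := h₁
  obtain ⟨C', K', hC'⟩ := h₂
  refine ⟨2 * C + 2 * C', max K K', fun k hk => ?_⟩
  have h3 := hC k ((le_max_left _ _).trans hk)
  have h4 := hC' k ((le_max_right _ _).trans hk)
  have h5 := integral_le_of_le_add (P := P) (c₁ := 2) (c₂ := 2) (b := 0)
    (integrable_pow_of_bounded (h.measurable_estimateError k hij j)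
      (h.exists_abs_estimateError_le k hij j) 2)
    (integrable_pow_of_bounded (h.measurable_error k j) (h.exists_abs_error_le k j) 2)
    (integrable_pow_of_bounded (h.measurable_estimateError k hij (Fin.last n))
      (h.exists_abs_estimateError_le k hij _) 2)
    fun ω => by
      nlinarith [sq_nonneg ((xhat k i j ω - x k (Fin.last n) ω)
        + (x k j ω - x k (Fin.last n) ω))]
  linarith

/-- Without any decay, the bound of all trajectories still gives the rate for exponents `s ≤ 0`. -/
theorem IsCRS.exists_meanSquare_bound_of_nonpos {f : ℕ → ℝ} {F : ℝ → ℝ}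
    (h : IsCRS G f R β F thr x xhat ξ) (hpos : ∀ i : Fin n, 0 < neighborCount G i.castSucc)
    {s : ℝ} (hs : s ≤ 0) :
    (∀ i : Fin (n + 1), ∃ (C : ℝ) (K : ℕ), ∀ k, K ≤ k →
      ∫ ω, (x k i ω - x k (Fin.last n) ω) ^ 2 ∂P ≤ C * (1 / (k : ℝ)) ^ s) ∧
    ∀ (i : Fin n) (j : Fin (n + 1)), G.Adj j i.castSucc → ∃ (C : ℝ) (K : ℕ), ∀ k, K ≤ k →
      ∫ ω, (xhat k i j ω - x k (Fin.last n) ω) ^ 2 ∂P ≤ C * (1 / (k : ℝ)) ^ s := by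
  have hmain : ∀ g : ℕ → Ω → ℝ, (∀ k, Measurable (g k)) →
      (∀ k, n + 1 ≤ k → ∀ ω, |g k ω| ≤ 2 * R) → ∃ (C : ℝ) (K : ℕ), ∀ k, K ≤ k →
      ∫ ω, g k ω ^ 2 ∂P ≤ C * (1 / (k : ℝ)) ^ s := by
    intro g hgm hg
    refine ⟨(2 * R) ^ 2, n + 1, fun k hk => ?_⟩
    have hk1 : (1 : ℝ) ≤ k := by exact_mod_cast le_trans (by omega) hk
    have h1 : 1 ≤ (1 / (k : ℝ)) ^ s :=
      Real.one_le_rpow_of_pos_of_le_one_of_nonpos (by positivity)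
        ((div_le_one (by linarith)).2 hk1) hs
    have h2 : ∫ ω, g k ω ^ 2 ∂P ≤ ∫ _, (2 * R) ^ 2 ∂P :=
      integral_mono (integrable_pow_of_bounded (hgm k) ⟨_, hg k hk⟩ 2) (integrable_const _)
        fun ω => sq_le_sq' (abs_le.1 (hg k hk ω)).1 (abs_le.1 (hg k hk ω)).2
    rw [integral_const, probReal_univ, one_smul] at h2
    exact h2.trans (le_mul_of_one_le_right (sq_nonneg _) h1)
  refine ⟨fun i => hmain _ (fun k => h.measurable_error k i) fun k hk ω => ?_,
    fun i j hij => hmain _ (fun k => h.measurable_estimateError k hij _) fun k hk ω => ?_⟩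
  · exact (abs_sub _ _).trans
      (by linarith [h.abs_state_le hpos hk i ω, h.leader_bound k ω])
  · exact (abs_sub _ _).trans
      (by linarith [h.abs_estimate_le k hij ω, h.leader_bound k ω])

end MeanSquareRate

end ConsensusTracking

theorem theorem2 {n : ℕ} (hn : 0 < n)
    (G : Digraph (Fin (n + 1))) [DecidableRel G.Adj]
    (hleader : ∀ j : Fin n, ¬ G.Adj j.castSucc (Fin.last n))
    (htree : ConsensusTracking.HasDirectedSpanningTree G (Fin.last n))
    -- the left null vector of the Laplacian, the block reduction and the Lyapunov matrix
    (π : Fin (n + 1) → ℝ)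
    (hπ : Matrix.vecMul π (ConsensusTracking.laplacian G) = 0) (hπ1 : ∑ i, π i = 1)
    (q : Matrix (Fin (n + 1)) Unit ℂ) (ψ : Matrix (Fin (n + 1)) (Fin n) ℂ)
    (τ : Matrix Unit (Fin (n + 1)) ℂ) (φ : Matrix (Fin n) (Fin (n + 1)) ℂ)
    (Lt : Matrix (Fin n) (Fin n) ℂ)
    (hΘ : ConsensusTracking.IsBlockReduction (ConsensusTracking.laplacian G) q ψ τ φ Lt)
    (H : Matrix (Fin n) (Fin n) ℂ) (hH : H.PosDef)
    (hLyap : H * Lt + Lt.conjTranspose * H = 1)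
    -- the algorithm, driven by Gaussian noise
    {Ω : Type*} [MeasurableSpace Ω] (P : Measure Ω) [IsProbabilityMeasure P]
    (v : ℝ≥0) (hv : v ≠ 0) (ε R β : ℝ) (hε0 : 0 < ε) (hε1 : ε < 1)
    (thr : Fin n → Fin (n + 1) → ℝ)
    (x : ℕ → Fin (n + 1) → Ω → ℝ) (xhat ξ : ℕ → Fin n → Fin (n + 1) → Ω → ℝ)
    (hnoise : ConsensusTracking.IsLinkNoise G P v x xhat ξ)
    (hcrs : ConsensusTracking.IsCRS G (fun k => 1 / (k : ℝ) ^ (1 + ε)) R β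
      (fun y => cdf (gaussianReal 0 v) y) thr x xhat ξ)
    (Q : Matrix (Fin 2) (Fin 2) ℝ)
    (hQ : Q = ConsensusTracking.rateMatrix G π φ H β
      (gaussianPDFReal 0 v (ConsensusTracking.maxThreshold G thr + R))) :
    (∀ (i : Fin n) (j : Fin (n + 1)), G.Adj j i.castSucc →
      ConsensusTracking.HasThreeCaseRate P (fun k ω => xhat k i j ω - x k j ω) ε
        (ConsensusTracking.lamMin Q)) ∧
    (∀ i : Fin n,
      ConsensusTracking.HasThreeCaseRate P
        (fun k ω => x k i.castSucc ω - x k (Fin.last n) ω) ε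
        (ConsensusTracking.lamMin Q)) := by
  have hpos := ConsensusTracking.neighborCount_pos htree
  set s := min (ConsensusTracking.lamMin Q) ε with hs
  have hbound : (∀ i : Fin (n + 1), ∃ (C : ℝ) (K : ℕ), ∀ k, K ≤ k →
      ∫ ω, (x k i ω - x k (Fin.last n) ω) ^ 2 ∂P ≤ C * (1 / (k : ℝ)) ^ s) ∧
      ∀ (i : Fin n) (j : Fin (n + 1)), G.Adj j i.castSucc → ∃ (C : ℝ) (K : ℕ), ∀ k, K ≤ k →
        ∫ ω, (xhat k i j ω - x k (Fin.last n) ω) ^ 2 ∂P ≤ C * (1 / (k : ℝ)) ^ s := by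
    -- for a nonpositive exponent, boundedness of the trajectories suffices
    rcases le_or_gt (ConsensusTracking.lamMin Q) 0 with hρ | hρ
    · exact hcrs.exists_meanSquare_bound_of_nonpos hpos (min_le_of_left_le hρ)
    have hleft : ConsensusTracking.lamMin Q ≤ 1 / (2 * ConsensusTracking.lamMax H) := by
      rw [hQ]; exact ConsensusTracking.lamMin_rateMatrix_le_left _ _ _ _ _
    set D := ConsensusTracking.maxThreshold G thr + R with hD
    have hright : ConsensusTracking.lamMin Q ≤ 2 * (β * gaussianPDFReal 0 v D)
        - 2 * ConsensusTracking.maxNeighborCount G := by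
      rw [hQ]; exact ConsensusTracking.lamMin_rateMatrix_le_right _ _ hH _ _
    have hd : (0 : ℝ) < ConsensusTracking.maxNeighborCount G := by
      exact_mod_cast (hpos ⟨0, hn⟩).trans_le (ConsensusTracking.neighborCount_le_maxNeighborCount _)
    have hβ : 0 < β :=
      pos_of_mul_pos_left (by linarith) (gaussianPDFReal_nonneg 0 v D)
    have hlamH : 0 < ConsensusTracking.lamMax H := by
      have := one_div_pos.1 (hρ.trans_le hleft); linarith
    obtain ⟨w, t, σ, hw, ht, hσρ, hσ, hσw⟩ := ConsensusTracking.exists_weights (G := G)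
      (γ := β * gaussianPDFReal 0 v D) hρ hd (by linarith)
      (fun i => by exact_mod_cast ConsensusTracking.neighborCount_le_maxNeighborCount i)
      (fun r hr0 hr w hw => ConsensusTracking.eq_zero_of_followerLaplacian_mulVec hleader hΘ hH
        hLyap hr0 (by
          have := hr.trans_le hleft
          rw [lt_div_iff₀ (by linarith)] at this; linarith) hw)
    refine hcrs.exists_meanSquare_bound hnoise hv hε0 hε1 hβ hpos (D := D) (fun i j hij => ?_) ht
      hw hσ hσw (lt_min hρ hε0) (min_le_right _ _)
      ((div_le_div_of_nonneg_right (min_le_left _ _) zero_le_two).trans_lt hσρ)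
    rw [hD]
    gcongr
    exact le_ciSup (f := fun p : ConsensusTracking.Link G => |thr p.1.1 p.1.2|)
      (Set.finite_range _).bddAbove ⟨(i, j), hij⟩
  refine ⟨fun i j hij => ?_, fun i => ?_⟩
  · obtain ⟨C, K, hC⟩ := hcrs.exists_meanSquare_link_bound hij (hbound.1 j) (hbound.2 i j hij)
    exact ConsensusTracking.hasThreeCaseRate_of_bound (fun k =>
      ConsensusTracking.memLp_two_of_bounded (hcrs.measurable_estimateError k hij j)
        (hcrs.exists_abs_estimateError_le k hij j)) hC
  · obtain ⟨C, K, hC⟩ := hbound.1 i.castSucc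
    exact ConsensusTracking.hasThreeCaseRate_of_bound (fun k =>
      ConsensusTracking.memLp_two_of_bounded (hcrs.measurable_error k _)
        (hcrs.exists_abs_error_le k _)) hC
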